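/- **Theorem (Third Reidemeister move).** Let $n\ge 3$, let $R=\mathbb{Q}[x_1,\dots,x_n]$ be graded by $\deg_q x_k=2$, and regard $R$-bimodules as $\mathbb{Q}[\mathbf{x},\mathbf{y}]$-modules ($\mathbf{y}$ acting on the left, $\mathbf{x}$ on the right). For $1\le i\le n-1$ let $$B_i=\mathbb{Q}[\mathbf{x},\mathbf{y}]\big/\big(y_i+y_{i+1}-x_i-x_{i+1},\; y_iy_{i+1}-x_ix_{i+1},\; y_k-x_k\ (k\ne i,i+1)\big)$$ with the descending filtration $F_j B_i=B_i$ for $j\le 0$, $F_1B_i=\big((y_{i+1}-y_i)-(x_{i+1}-x_i)\big)B_i$ and $F_jB_i=0$ for $j\ge 2$, and let $\mathbf{1}=\mathbb{Q}[\mathbf{x},\mathbf{y}]/(y_k-x_k,\ 1\le k\le n)$ have the trivial filtration $F_j\mathbf 1=\mathbf 1$ for $j\le 0$, $F_j\mathbf 1=0$ for $j>0$. Let the filtered Rouquier complex of $\sigma_i^{-1}$ be the two-term complex $[\,B_i\xrightarrow{\ 1\mapsto 1\ }\mathbf{1}\,]$ with $B_i$ in homological degree $1$ and $\mathbf 1$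 in homological degree $0$, and let the filtered Rouquier complex of a product of such generators be the tensor product over $R$ of their complexes, with the tensor product filtration (the overall degree shift, which depends only on the number of crossings, is omitted). Then for $1\le i\le n-2$ there is a homotopy equivalence of complexes of graded $R$-bimodules $$f_{lr}\colon\ \langle\sigma_i^{-1}\sigma_{i+1}^{-1}\sigma_i^{-1}\rangle\ \rightleftarrows\ \langle\sigma_{i+1}^{-1}\sigma_i^{-1}\sigma_{i+1}^{-1}\rangle\ :\! f_{rl}$$ whose two maps both violate the filtration by at most two units, that is, $f_{lr}(F_j)\subseteq F_{j-2}$ and $f_{rl}(F_j)\subseteq F_{j-2}$ for all $j\in\mathbb{Z}$. -/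

import Mathlib

open scoped TensorProduct

noncomputable section

namespace FilteredRouquier

/-! ### Helper facts on gradings of vector spaces -/

section Gradings

variable {ι : Type} [DecidableEq ι]
variable {M : Type} [AddCommGroup M] [Module ℚ M] {N : Type} [AddCommGroup N] [Module ℚ N]

theorem isInternal_of_splitting (gr : ι → Submodule ℚ M) (htop : (⨆ a, gr a) = ⊤)
    (Δ : M →ₗ[ℚ] (ι →₀ M)) (hΔ : ∀ a, ∀ m ∈ gr a, Δ m = Finsupp.single a m) :
    DirectSum.IsInternal gr := by
  rw [DirectSum.isInternal_submodule_iff_iSupIndep_and_iSup_eq_top]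
  refine ⟨?_, htop⟩
  rw [iSupIndep_def]
  intro a
  rw [Submodule.disjoint_def]
  intro x hx hx'
  have h1 : (⨆ b, ⨆ (_ : b ≠ a), gr b) ≤ LinearMap.ker ((Finsupp.lapply a) ∘ₗ Δ) := by
    refine iSup_le fun b => iSup_le fun hb m hm => ?_
    simp [hΔ b m hm, hb]
  have h2 := h1 hx'
  simpa [hΔ a x hx] using h2

theorem exists_splitting (gr : ι → Submodule ℚ M) (h : DirectSum.IsInternal gr) :
    ∃ Δ : M →ₗ[ℚ] (ι →₀ M), ∀ a, ∀ m ∈ gr a, Δ m = Finsupp.single a m := by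
  let e := LinearEquiv.ofBijective (DirectSum.coeLinearMap gr) h
  refine ⟨(DirectSum.toModule ℚ ι (ι →₀ M)
    (fun a => (Finsupp.lsingle a) ∘ₗ (gr a).subtype)) ∘ₗ e.symm.toLinearMap, ?_⟩
  intro a m hm
  have : e.symm m = DirectSum.lof ℚ ι (fun a => gr a) a ⟨m, hm⟩ := by
    rw [LinearEquiv.symm_apply_eq]
    exact (DirectSum.coeLinearMap_lof gr a ⟨m, hm⟩).symm
  simp [this]

theorem isInternal_map (gr : ι → Submodule ℚ M) (h : DirectSum.IsInternal gr)
    (π : M →ₗ[ℚ] N) (hπ : Function.Surjective π)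
    (hK : ∀ φ : M →ₗ[ℚ] (ι →₀ N),
      (∀ a, ∀ m ∈ gr a, φ m = Finsupp.single a (π m)) → LinearMap.ker π ≤ LinearMap.ker φ) :
    DirectSum.IsInternal (fun a => (gr a).map π) := by
  obtain ⟨Δ, hΔ⟩ := exists_splitting gr h
  have hφ : ∀ a, ∀ m ∈ gr a, ((Finsupp.mapRange.linearMap π) ∘ₗ Δ) m
      = Finsupp.single a (π m) := by
    intro a m hm
    simp [hΔ a m hm]
  refine isInternal_of_splitting _ ?_ (((LinearMap.ker π).liftQ _ (hK _ hφ)) ∘ₗ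
    (π.quotKerEquivOfSurjective hπ).symm.toLinearMap) ?_
  · rw [← Submodule.map_iSup, h.submodule_iSup_eq_top, Submodule.map_top,
      LinearMap.range_eq_top.2 hπ]
  · rintro a _ ⟨m, hm, rfl⟩
    have : (π.quotKerEquivOfSurjective hπ).symm (π m) = (LinearMap.ker π).mkQ m := by
      rw [LinearEquiv.symm_apply_eq]; rfl
    rw [LinearMap.comp_apply, LinearEquiv.coe_coe, this, Submodule.mkQ_apply,
      Submodule.liftQ_apply]
    exact hφ a m hm

theorem linearMap_eq_of_internal {gr : ι → Submodule ℚ M} (h : DirectSum.IsInternal gr)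
    {f g : M →ₗ[ℚ] N} (hfg : ∀ a, ∀ m ∈ gr a, f m = g m) : f = g := by
  have : (⊤ : Submodule ℚ M) ≤ LinearMap.eqLocus f g := by
    rw [← h.submodule_iSup_eq_top]
    exact iSup_le fun a m hm => hfg a m hm
  ext m
  exact this (Submodule.mem_top (x := m))

/-- The family of subspaces of `M ⊗ N` induced by families of subspaces of `M` and `N`:
`(A * B) c` is the sum over all `a` of the images of `A a ⊗ B (c - a)`. -/
def conv {G : Type} [AddCommGroup G] (A : G → Submodule ℚ M) (B : G → Submodule ℚ N) (c : G) :
    Submodule ℚ (M ⊗[ℚ] N) :=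
  ⨆ a : G, Submodule.map₂ (TensorProduct.mk ℚ M N) (A a) (B (c - a))

theorem conv_le {G : Type} [AddCommGroup G] {A : G → Submodule ℚ M} {B : G → Submodule ℚ N}
    {c : G} {K : Submodule ℚ (M ⊗[ℚ] N)}
    (h : ∀ a b, a + b = c → ∀ m ∈ A a, ∀ n ∈ B b, m ⊗ₜ[ℚ] n ∈ K) : conv A B c ≤ K :=
  iSup_le fun a => Submodule.map₂_le.2 fun m hm n hn => h a (c - a) (by abel) m hm n hn

theorem tmul_mem_conv {G : Type} [AddCommGroup G] {A : G → Submodule ℚ M}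
    {B : G → Submodule ℚ N} {a b c : G} (hc : a + b = c) {m : M} (hm : m ∈ A a) {n : N}
    (hn : n ∈ B b) : m ⊗ₜ[ℚ] n ∈ conv A B c := by
  have hb : b = c - a := by rw [← hc]; abel
  subst hb
  exact Submodule.mem_iSup_of_mem a (Submodule.apply_mem_map₂ _ hm hn)

theorem conv_map {G : Type} [AddCommGroup G] {A : G → Submodule ℚ M} {B : G → Submodule ℚ N}
    {f : M →ₗ[ℚ] M} {g : N →ₗ[ℚ] N} {e e' c c' : G}
    (hf : ∀ a, ∀ m ∈ A a, f m ∈ A (a + e)) (hg : ∀ b, ∀ n ∈ B b, g n ∈ B (b + e'))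
    (hc : c + (e + e') = c') : conv A B c ≤ (conv A B c').comap (TensorProduct.map f g) :=
  conv_le fun a b hab m hm n hn =>
    tmul_mem_conv (by rw [← hc, ← hab]; abel) (hf a m hm) (hg b n hn)

theorem conv_iSup_eq_top {G : Type} [AddCommGroup G] {A : G → Submodule ℚ M}
    {B : G → Submodule ℚ N} (hA : (⨆ a, A a) = ⊤) (hB : (⨆ b, B b) = ⊤) :
    (⨆ c, conv A B c) = ⊤ := by
  rw [eq_top_iff, ← TensorProduct.map₂_mk_top_top_eq_top, ← hA, ← hB, Submodule.map₂_iSup_left]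
  refine iSup_le fun a => ?_
  rw [Submodule.map₂_iSup_right]
  refine iSup_le fun b => le_iSup_of_le (a + b) ?_
  exact Submodule.map₂_le.2 fun m hm n hn => tmul_mem_conv rfl hm hn

theorem isInternal_conv {gr : ℤ × ℤ → Submodule ℚ M} (h : DirectSum.IsInternal gr)
    {gr' : ℤ × ℤ → Submodule ℚ N} (h' : DirectSum.IsInternal gr') :
    DirectSum.IsInternal (conv gr gr') := by
  obtain ⟨Δ, hΔ⟩ := exists_splitting gr h
  obtain ⟨Δ', hΔ'⟩ := exists_splitting gr' h'
  refine isInternal_of_splitting _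
    (conv_iSup_eq_top h.submodule_iSup_eq_top h'.submodule_iSup_eq_top)
    ((Finsupp.lmapDomain (M ⊗[ℚ] N) ℚ (fun p : (ℤ × ℤ) × (ℤ × ℤ) => p.1 + p.2)) ∘ₗ
      (finsuppTensorFinsupp ℚ ℚ M N (ℤ × ℤ) (ℤ × ℤ)).toLinearMap ∘ₗ TensorProduct.map Δ Δ') ?_
  intro c x hx
  have : conv gr gr' c ≤ LinearMap.eqLocus
    ((Finsupp.lmapDomain (M ⊗[ℚ] N) ℚ (fun p : (ℤ × ℤ) × (ℤ × ℤ) => p.1 + p.2)) ∘ₗ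
      (finsuppTensorFinsupp ℚ ℚ M N (ℤ × ℤ) (ℤ × ℤ)).toLinearMap ∘ₗ TensorProduct.map Δ Δ')
    (Finsupp.lsingle c) := by
    refine conv_le fun a b hab m hm n hn => ?_
    simp [hΔ a m hm, hΔ' b n hn, finsuppTensorFinsupp_single, Finsupp.mapDomain_single, hab]
  exact this hx

theorem mk_mem_of_mem {K : Submodule ℚ (M × N)} {u : M} {v : N} (hu : (u, 0) ∈ K)
    (hv : (0, v) ∈ K) : (u, v) ∈ K := by
  simpa using add_mem hu hv

end Gradings

/-! ### Filtered complexes of graded bimodules -/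

/-- A complex of filtered graded bimodules over `ℚ[x₁, …, xₙ]`, written as its total space: a
bigraded rational vector space (`gr (t, q)` is the part of homological degree `t` and of
`q`-degree `q`), with commuting left and right actions `l`, `r` of the polynomial ring whose
variables have `q`-degree `2`, a differential `d` that lowers the homological degree by one, and a
finite descending filtration `fil` by graded subbimodules that `d` preserves. In terms of
`ℚ[x, y]`-modules, `l` is the action of the variables `y` and `r` that of the variables `x`. -/
structure FilteredComplex (n : ℕ) where
  M : Type
  [addCommGroup : AddCommGroup M]
  [module : Module ℚ M]
  l : MvPolynomial (Fin n) ℚ →ₐ[ℚ] Module.End ℚ M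
  r : MvPolynomial (Fin n) ℚ →ₐ[ℚ] Module.End ℚ M
  l_r : ∀ p q m, l p (r q m) = r q (l p m)
  gr : ℤ × ℤ → Submodule ℚ M
  gr_internal : DirectSum.IsInternal gr
  gr_l : ∀ k a, ∀ m ∈ gr a, l (MvPolynomial.X k) m ∈ gr (a + (0, 2))
  gr_r : ∀ k a, ∀ m ∈ gr a, r (MvPolynomial.X k) m ∈ gr (a + (0, 2))
  d : M →ₗ[ℚ] M
  d_l : ∀ p m, d (l p m) = l p (d m)
  d_r : ∀ p m, d (r p m) = r p (d m)
  d_gr : ∀ a, ∀ m ∈ gr a, d m ∈ gr (a + (-1, 0))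
  d_d : ∀ m, d (d m) = 0
  fil : ℤ → Submodule ℚ M
  fil_antitone : Antitone fil
  fil_l : ∀ i p, ∀ m ∈ fil i, l p m ∈ fil i
  fil_r : ∀ i p, ∀ m ∈ fil i, r p m ∈ fil i
  fil_d : ∀ i, ∀ m ∈ fil i, d m ∈ fil i
  fil_gr : ∀ i, fil i ≤ ⨆ a, fil i ⊓ gr a
  fil_top : ∃ i, fil i = ⊤
  fil_bot : ∃ i, fil i = ⊥

attribute [instance] FilteredComplex.addCommGroup FilteredComplex.module

namespace FilteredComplex

variable {n : ℕ}

/-- `f` commutes with both actions of the polynomial ring. -/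
def IsBimoduleMap {C D : FilteredComplex n} (f : C.M →ₗ[ℚ] D.M) : Prop :=
  (∀ p m, f (C.l p m) = D.l p (f m)) ∧ ∀ p m, f (C.r p m) = D.r p (f m)

/-- `f` is homogeneous of homological degree `t` and of `q`-degree `0`. -/
def HasDegree {C D : FilteredComplex n} (t : ℤ) (f : C.M →ₗ[ℚ] D.M) : Prop :=
  ∀ a, ∀ m ∈ C.gr a, f m ∈ D.gr (a + (t, 0))

/-- `f` violates the filtration by (at most) `k` units: it is a filtered map from `C` to the
shift of `D` whose `i`-th filtration step is the `(i - k)`-th one of `D`. -/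
def Violates {C D : FilteredComplex n} (k : ℤ) (f : C.M →ₗ[ℚ] D.M) : Prop :=
  ∀ i, ∀ m ∈ C.fil i, f m ∈ D.fil (i - k)

/-- A homotopy equivalence between the complexes of graded bimodules underlying `C` and `D`; no
compatibility with the filtrations is required. -/
structure HomotopyEquiv (C D : FilteredComplex n) where
  f : C.M →ₗ[ℚ] D.M
  g : D.M →ₗ[ℚ] C.M
  hC : C.M →ₗ[ℚ] C.M
  hD : D.M →ₗ[ℚ] D.M
  f_bim : IsBimoduleMap f
  g_bim : IsBimoduleMap g
  hC_bim : IsBimoduleMap hC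
  hD_bim : IsBimoduleMap hD
  f_deg : HasDegree 0 f
  g_deg : HasDegree 0 g
  hC_deg : HasDegree 1 hC
  hD_deg : HasDegree 1 hD
  f_d : ∀ m, f (C.d m) = D.d (f m)
  g_d : ∀ m, g (D.d m) = C.d (g m)
  g_f : ∀ m, g (f m) - m = C.d (hC m) + hC (C.d m)
  f_g : ∀ m, f (g m) - m = D.d (hD m) + hD (D.d m)

/-! ### The tensor product over the intermediate variables -/

/-- The operator that acts on homological degree `t` as multiplication by `(-1) ^ t`. -/
def sgn (C : FilteredComplex n) : C.M →ₗ[ℚ] C.M :=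
  (DirectSum.toModule ℚ (ℤ × ℤ) C.M
    (fun a => (((Int.negOnePow a.1 : ℤˣ) : ℤ) : ℚ) • (C.gr a).subtype)) ∘ₗ
    (LinearEquiv.ofBijective (DirectSum.coeLinearMap C.gr) C.gr_internal).symm.toLinearMap

theorem sgn_apply (C : FilteredComplex n) {a : ℤ × ℤ} {m : C.M} (hm : m ∈ C.gr a) :
    C.sgn m = (((Int.negOnePow a.1 : ℤˣ) : ℤ) : ℚ) • m := by
  have : (LinearEquiv.ofBijective (DirectSum.coeLinearMap C.gr) C.gr_internal).symm m
      = DirectSum.lof ℚ (ℤ × ℤ) (fun a => C.gr a) a ⟨m, hm⟩ := by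
    rw [LinearEquiv.symm_apply_eq]
    exact (DirectSum.coeLinearMap_lof C.gr a ⟨m, hm⟩).symm
  simp [sgn, this]

theorem sgn_d (C : FilteredComplex n) (m : C.M) : C.sgn (C.d m) = - C.d (C.sgn m) := by
  have : C.sgn ∘ₗ C.d = - (C.d ∘ₗ C.sgn) := by
    refine linearMap_eq_of_internal C.gr_internal fun a m hm => ?_
    simp [C.sgn_apply hm, C.sgn_apply (C.d_gr a m hm), Int.negOnePow_add]
  exact LinearMap.congr_fun this m

theorem sgn_comm (C : FilteredComplex n) (ρ : MvPolynomial (Fin n) ℚ →ₐ[ℚ] Module.End ℚ C.M)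
    (h : ∀ k a, ∀ m ∈ C.gr a, ρ (MvPolynomial.X k) m ∈ C.gr (a + (0, 2)))
    (p : MvPolynomial (Fin n) ℚ) (m : C.M) : C.sgn (ρ p m) = ρ p (C.sgn m) := by
  induction p using MvPolynomial.induction_on generalizing m with
  | C a => 
    have : ρ (MvPolynomial.C a) = algebraMap ℚ _ a := ρ.commutes a
    simp [this]
  | add p q hp hq => simp [hp, hq]
  | mul_X p k hp =>
    have : C.sgn ∘ₗ ρ (MvPolynomial.X k) = ρ (MvPolynomial.X k) ∘ₗ C.sgn := by
      refine linearMap_eq_of_internal C.gr_internal fun a m hm => ?_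
      simp [C.sgn_apply hm, C.sgn_apply (h k a m hm)]
    have h2 := LinearMap.congr_fun this m
    simp only [LinearMap.comp_apply] at h2
    simp [hp, h2]

theorem sgn_mem (C : FilteredComplex n) (a : ℤ × ℤ) (m : C.M) (hm : m ∈ C.gr a) :
    C.sgn m ∈ C.gr a := by
  rw [C.sgn_apply hm]
  exact Submodule.smul_mem _ _ hm

theorem sgn_fil (C : FilteredComplex n) (i : ℤ) (m : C.M) (hm : m ∈ C.fil i) :
    C.sgn m ∈ C.fil i := by
  have : (⨆ a, C.fil i ⊓ C.gr a) ≤ (C.fil i).comap C.sgn := by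
    refine iSup_le fun a m hm => ?_
    rw [Submodule.mem_comap, C.sgn_apply hm.2]
    exact Submodule.smul_mem _ _ hm.1
  exact this (C.fil_gr i hm)

/-- The relations `(m · p) ⊗ m' = m ⊗ (p · m')`. -/
def rel (C D : FilteredComplex n) : Submodule ℚ (C.M ⊗[ℚ] D.M) :=
  Submodule.span ℚ {t | ∃ p m m', t = C.r p m ⊗ₜ[ℚ] m' - m ⊗ₜ[ℚ] D.l p m'}

theorem rel_le_comap (C D : FilteredComplex n) {f : C.M →ₗ[ℚ] C.M} {g : D.M →ₗ[ℚ] D.M}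
    (hf : ∀ p m, f (C.r p m) = C.r p (f m)) (hg : ∀ p m, g (D.l p m) = D.l p (g m)) :
    rel C D ≤ (rel C D).comap (TensorProduct.map f g) := by
  refine Submodule.span_le.2 ?_
  rintro _ ⟨p, m, m', rfl⟩
  simp only [Submodule.comap_coe, Set.mem_preimage, map_sub, TensorProduct.map_tmul, hf, hg,
    SetLike.mem_coe]
  exact Submodule.subset_span ⟨p, f m, g m', rfl⟩

/-- The endomorphism `f ⊗ g` of the tensor product over the polynomial ring. -/
def tensorEnd (C D : FilteredComplex n) (f : C.M →ₗ[ℚ] C.M) (g : D.M →ₗ[ℚ] D.M)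
    (hf : ∀ p m, f (C.r p m) = C.r p (f m)) (hg : ∀ p m, g (D.l p m) = D.l p (g m)) :
    Module.End ℚ ((C.M ⊗[ℚ] D.M) ⧸ rel C D) :=
  (rel C D).mapQ (rel C D) (TensorProduct.map f g) (rel_le_comap C D hf hg)

theorem tensorEnd_apply (C D : FilteredComplex n) (f : C.M →ₗ[ℚ] C.M) (g : D.M →ₗ[ℚ] D.M)
    (hf : ∀ p m, f (C.r p m) = C.r p (f m)) (hg : ∀ p m, g (D.l p m) = D.l p (g m))
    (m : C.M) (m' : D.M) :
    tensorEnd C D f g hf hg ((rel C D).mkQ (m ⊗ₜ m')) = (rel C D).mkQ (f m ⊗ₜ g m') := by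
  simp [tensorEnd]

theorem tensor_ext (C D : FilteredComplex n) {N : Type} [AddCommGroup N] [Module ℚ N]
    {φ ψ : ((C.M ⊗[ℚ] D.M) ⧸ rel C D) →ₗ[ℚ] N}
    (h : ∀ m m', φ ((rel C D).mkQ (m ⊗ₜ m')) = ψ ((rel C D).mkQ (m ⊗ₜ m'))) : φ = ψ := by
  apply Submodule.linearMap_qext
  apply TensorProduct.ext'
  exact h

theorem rel_le_ker (C D : FilteredComplex n) {N : Type} [AddCommGroup N] [Module ℚ N]
    (φ : (C.M ⊗[ℚ] D.M) →ₗ[ℚ] N)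
    (h : ∀ k a b, ∀ m ∈ C.gr a, ∀ m' ∈ D.gr b,
      φ (C.r (MvPolynomial.X k) m ⊗ₜ m') = φ (m ⊗ₜ D.l (MvPolynomial.X k) m')) :
    rel C D ≤ LinearMap.ker φ := by
  have hX : ∀ k m m', φ (C.r (MvPolynomial.X k) m ⊗ₜ m') = φ (m ⊗ₜ D.l (MvPolynomial.X k) m') := by
    intro k m m'
    have h1 : (TensorProduct.curry φ) ∘ₗ C.r (MvPolynomial.X k)
        = (LinearMap.lcomp ℚ N (D.l (MvPolynomial.X k))) ∘ₗ TensorProduct.curry φ := by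
      refine linearMap_eq_of_internal C.gr_internal fun a m hm => ?_
      refine linearMap_eq_of_internal D.gr_internal fun b m' hm' => ?_
      simpa using h k a b m hm m' hm'
    simpa using LinearMap.congr_fun (LinearMap.congr_fun h1 m) m'
  have hp : ∀ p m m', φ (C.r p m ⊗ₜ m') = φ (m ⊗ₜ D.l p m') := by
    intro p
    induction p using MvPolynomial.induction_on with
    | C a =>
      intro m m'
      have h1 : C.r (MvPolynomial.C a) = algebraMap ℚ _ a := C.r.commutes a
      have h2 : D.l (MvPolynomial.C a) = algebraMap ℚ _ a := D.l.commutes a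
      simp [h1, h2, TensorProduct.smul_tmul]
    | add p q hp hq => intro m m'; simp [TensorProduct.add_tmul, TensorProduct.tmul_add, hp, hq]
    | mul_X p k hp =>
      intro m m'
      rw [map_mul, mul_comm p, map_mul, Module.End.mul_apply, Module.End.mul_apply, hp, hX]
  refine Submodule.span_le.2 ?_
  rintro _ ⟨p, m, m', rfl⟩
  simp [hp]

theorem tensorEnd_mem (C D : FilteredComplex n) {f : C.M →ₗ[ℚ] C.M} {g : D.M →ₗ[ℚ] D.M}
    (hf : ∀ p m, f (C.r p m) = C.r p (f m)) (hg : ∀ p m, g (D.l p m) = D.l p (g m))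
    {G : Type} [AddCommGroup G] {A : G → Submodule ℚ C.M} {B : G → Submodule ℚ D.M}
    {e e' c c' : G} (hfA : ∀ a, ∀ m ∈ A a, f m ∈ A (a + e))
    (hgB : ∀ b, ∀ m ∈ B b, g m ∈ B (b + e')) (hc : c + (e + e') = c') :
    ∀ x ∈ (conv A B c).map (rel C D).mkQ,
      tensorEnd C D f g hf hg x ∈ (conv A B c').map (rel C D).mkQ := by
  rintro _ ⟨x, hx, rfl⟩
  exact ⟨TensorProduct.map f g x, conv_map hfA hgB hc hx, by simp [tensorEnd]⟩

/-- The differential `m ⊗ m' ↦ d m ⊗ m' + (-1) ^ t m ⊗ d m'` for `m` of homological degree `t`. -/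
def tensorD (C D : FilteredComplex n) : Module.End ℚ ((C.M ⊗[ℚ] D.M) ⧸ rel C D) :=
  tensorEnd C D C.d LinearMap.id C.d_r (fun _ _ => rfl) +
    tensorEnd C D C.sgn D.d (C.sgn_comm C.r C.gr_r) D.d_l

theorem tensorD_comp (C D : FilteredComplex n) : tensorD C D ∘ₗ tensorD C D = 0 :=
  tensor_ext C D fun m m' => by
    simp [tensorD, tensorEnd, C.d_d, D.d_d, C.sgn_d, TensorProduct.neg_tmul]

theorem tensorD_comm (C D : FilteredComplex n) {f : C.M →ₗ[ℚ] C.M} {g : D.M →ₗ[ℚ] D.M}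
    (hf : ∀ p m, f (C.r p m) = C.r p (f m)) (hg : ∀ p m, g (D.l p m) = D.l p (g m))
    (hfd : ∀ m, C.d (f m) = f (C.d m)) (hgd : ∀ m, D.d (g m) = g (D.d m))
    (hfs : ∀ m, C.sgn (f m) = f (C.sgn m)) :
    tensorD C D ∘ₗ tensorEnd C D f g hf hg = tensorEnd C D f g hf hg ∘ₗ tensorD C D :=
  tensor_ext C D fun m m' => by
    simp [tensorD, tensorEnd, hfd, hgd, hfs]

/-- The left action on the tensor product: that of the first factor. -/
def tensorL (C D : FilteredComplex n) :
    MvPolynomial (Fin n) ℚ →ₐ[ℚ] Module.End ℚ ((C.M ⊗[ℚ] D.M) ⧸ rel C D) where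
  toFun p := tensorEnd C D (C.l p) LinearMap.id (C.l_r p) (fun _ _ => rfl)
  map_one' := tensor_ext C D fun m m' => by simp [tensorEnd]
  map_mul' p q := tensor_ext C D fun m m' => by simp [tensorEnd]
  map_zero' := tensor_ext C D fun m m' => by simp [tensorEnd]
  map_add' p q := tensor_ext C D fun m m' => by simp [tensorEnd, TensorProduct.add_tmul]
  commutes' a := tensor_ext C D fun m m' => by simp [tensorEnd, ← TensorProduct.smul_tmul']

/-- The right action on the tensor product: that of the second factor. -/
def tensorR (C D : FilteredComplex n) :
    MvPolynomial (Fin n) ℚ →ₐ[ℚ] Module.End ℚ ((C.M ⊗[ℚ] D.M) ⧸ rel C D) where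
  toFun p := tensorEnd C D LinearMap.id (D.r p) (fun _ _ => rfl) (fun q m => (D.l_r q p m).symm)
  map_one' := tensor_ext C D fun m m' => by simp [tensorEnd]
  map_mul' p q := tensor_ext C D fun m m' => by simp [tensorEnd]
  map_zero' := tensor_ext C D fun m m' => by simp [tensorEnd]
  map_add' p q := tensor_ext C D fun m m' => by simp [tensorEnd, TensorProduct.tmul_add]
  commutes' a := tensor_ext C D fun m m' => by simp [tensorEnd]

theorem tensorL_comp_tensorR (C D : FilteredComplex n) (p q : MvPolynomial (Fin n) ℚ) :
    tensorL C D p ∘ₗ tensorR C D q = tensorR C D q ∘ₗ tensorL C D p :=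
  tensor_ext C D fun m m' => by simp [tensorL, tensorR, tensorEnd]

theorem tensorD_comp_tensorL (C D : FilteredComplex n) (p : MvPolynomial (Fin n) ℚ) :
    tensorD C D ∘ₗ tensorL C D p = tensorL C D p ∘ₗ tensorD C D :=
  tensorD_comm C D (C.l_r p) (fun _ _ => rfl) (C.d_l p) (fun _ => rfl) (C.sgn_comm C.l C.gr_l p)

theorem tensorD_comp_tensorR (C D : FilteredComplex n) (p : MvPolynomial (Fin n) ℚ) :
    tensorD C D ∘ₗ tensorR C D p = tensorR C D p ∘ₗ tensorD C D :=
  tensorD_comm C D (fun _ _ => rfl) (fun q m => (D.l_r q p m).symm) (fun _ => rfl) (D.d_r p)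
    (fun _ => rfl)

/-- The tensor product of two complexes over the intermediate variables (the right action on `C`
and the left action on `D`), with the usual sign in the differential, the total bigrading and the
tensor product filtration. -/
def tensor (C D : FilteredComplex n) : FilteredComplex n where
  M := (C.M ⊗[ℚ] D.M) ⧸ rel C D
  l := tensorL C D
  r := tensorR C D
  l_r := fun p q => LinearMap.congr_fun (tensorL_comp_tensorR C D p q)
  gr := fun c => (conv C.gr D.gr c).map (rel C D).mkQ
  gr_internal := by
    refine isInternal_map _ (isInternal_conv C.gr_internal D.gr_internal) _
      (Submodule.mkQ_surjective _) fun φ hφ => ?_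
    rw [Submodule.ker_mkQ]
    refine rel_le_ker C D φ fun k a b m hm m' hm' => ?_
    rw [hφ (a + b + (0, 2)) _ (tmul_mem_conv (by abel) (C.gr_r k a m hm) hm'),
      hφ (a + b + (0, 2)) _ (tmul_mem_conv (by abel) hm (D.gr_l k b m' hm'))]
    congr 1
    rw [Submodule.mkQ_apply, Submodule.mkQ_apply, Submodule.Quotient.eq]
    exact Submodule.subset_span ⟨_, _, _, rfl⟩
  gr_l := fun k c => tensorEnd_mem C D (C.l_r _) (fun _ _ => rfl) (C.gr_l k) (e' := 0) (fun b m hm => by simpa using hm)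
    (by simp)
  gr_r := fun k c => tensorEnd_mem C D (fun _ _ => rfl) (fun q m => (D.l_r q _ m).symm) (e := 0) (fun b m hm => by simpa using hm) (D.gr_r k)
    (by simp)
  d := tensorD C D
  d_l := fun p => LinearMap.congr_fun (tensorD_comp_tensorL C D p)
  d_r := fun p => LinearMap.congr_fun (tensorD_comp_tensorR C D p)
  d_gr := fun c x hx => Submodule.add_mem _
    (tensorEnd_mem C D C.d_r (fun _ _ => rfl) C.d_gr (e' := 0) (fun b m hm => by simpa using hm) (by simp) x hx)
    (tensorEnd_mem C D (C.sgn_comm C.r C.gr_r) D.d_l (e := 0) (fun b m hm => by simpa using C.sgn_mem b m hm) D.d_gr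
      (by simp) x hx)
  d_d := LinearMap.congr_fun (tensorD_comp C D)
  fil := fun i => (conv C.fil D.fil i).map (rel C D).mkQ
  fil_antitone := fun i j hij => Submodule.map_mono (conv_le fun a b hab m hm m' hm' =>
    tmul_mem_conv (a := a - (j - i)) (b := b) (by omega)
      (C.fil_antitone (by omega) hm) hm')
  fil_l := fun i p => tensorEnd_mem C D (C.l_r _) (fun _ _ => rfl) (e := 0) (e' := 0)
    (fun b m hm => by simpa using C.fil_l b p m hm) (fun b m hm => by simpa using hm) (by simp)
  fil_r := fun i p => tensorEnd_mem C D (fun _ _ => rfl) (fun q m => (D.l_r q _ m).symm) (e := 0) (e' := 0)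
    (fun b m hm => by simpa using hm) (fun b m hm => by simpa using D.fil_r b p m hm) (by simp)
  fil_d := fun i x hx => Submodule.add_mem _
    (tensorEnd_mem C D C.d_r (fun _ _ => rfl) (e := 0) (e' := 0)
      (fun b m hm => by simpa using C.fil_d b m hm) (fun b m hm => by simpa using hm)
      (by simp) x hx)
    (tensorEnd_mem C D (C.sgn_comm C.r C.gr_r) D.d_l (e := 0) (e' := 0)
      (fun b m hm => by simpa using C.sgn_fil b m hm)
      (fun b m hm => by simpa using D.fil_d b m hm) (by simp) x hx)
  fil_gr := fun i => by
    refine Submodule.map_le_iff_le_comap.2 (iSup_le fun a => ?_)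
    refine (Submodule.map₂_le_map₂ (C.fil_gr a) (D.fil_gr (i - a))).trans ?_
    rw [Submodule.map₂_iSup_left]
    refine iSup_le fun b => ?_
    rw [Submodule.map₂_iSup_right]
    refine iSup_le fun c => Submodule.map₂_le.2 fun m hm m' hm' => ?_
    refine Submodule.mem_iSup_of_mem (b + c) ⟨⟨_, ?_, rfl⟩, ⟨_, ?_, rfl⟩⟩
    · exact tmul_mem_conv (by abel) hm.1 hm'.1
    · exact tmul_mem_conv rfl hm.2 hm'.2
  fil_top := by
    obtain ⟨i, hi⟩ := C.fil_top
    obtain ⟨j, hj⟩ := D.fil_top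
    refine ⟨i + j, ?_⟩
    rw [eq_top_iff, ← Submodule.range_mkQ, LinearMap.range_eq_map,
      ← TensorProduct.map₂_mk_top_top_eq_top, ← hi, ← hj]
    exact Submodule.map_mono (Submodule.map₂_le.2 fun m hm m' hm' => tmul_mem_conv rfl hm hm')
  fil_bot := by
    obtain ⟨i, hi⟩ := C.fil_bot
    obtain ⟨j, hj⟩ := D.fil_bot
    refine ⟨i + j, ?_⟩
    rw [eq_bot_iff, Submodule.map_le_iff_le_comap]
    refine conv_le fun a b hab m hm m' hm' => ?_
    rcases le_or_gt i a with h | h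
    · have := C.fil_antitone h hm
      rw [hi, Submodule.mem_bot] at this
      simp [this]
    · have := D.fil_antitone (show j ≤ b by omega) hm'
      rw [hj, Submodule.mem_bot] at this
      simp [this]

/-! ### Soergel bimodules and negative crossings -/

/-- The ring `ℚ[x, y]`; the variables `x` act from the right and the variables `y` from the
left. -/
abbrev Pxy (n : ℕ) : Type := MvPolynomial (Fin n ⊕ Fin n) ℚ

abbrev xv (k : Fin n) : Pxy n := MvPolynomial.X (Sum.inl k)

abbrev yv (k : Fin n) : Pxy n := MvPolynomial.X (Sum.inr k)

/-- The polynomials of `q`-degree `q`, each variable having degree `2`. -/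
abbrev polyGr (n : ℕ) (q : ℤ) : Submodule ℚ (Pxy n) :=
  MvPolynomial.weightedHomogeneousSubmodule ℚ (fun _ => (2 : ℤ)) q

/-- The part of `q`-degree `q` of the quotient ring `ℚ[x, y] / I`. -/
def quotGr (I : Ideal (Pxy n)) (q : ℤ) : Submodule ℚ (Pxy n ⧸ I) :=
  (polyGr n q).map (Ideal.Quotient.mkₐ ℚ I).toLinearMap

/-- The bimodule of the identity braid is `ℚ[x, y]` modulo this ideal. -/
def idIdeal (n : ℕ) : Ideal (Pxy n) :=
  Ideal.span (Set.range fun k : Fin n => yv k - xv k)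

/-- The blob bimodule on the strands `a`, `b` is `ℚ[x, y]` modulo this ideal. -/
def blobIdeal (a b : Fin n) : Ideal (Pxy n) :=
  Ideal.span ({(yv a + yv b) - (xv a + xv b), yv a * yv b - xv a * xv b} ∪
    (fun k => yv k - xv k) '' {k | k ≠ a ∧ k ≠ b})

theorem blobIdeal_le_idIdeal (a b : Fin n) : blobIdeal a b ≤ idIdeal n := by
  have h : ∀ k, yv k - xv k ∈ idIdeal n := fun k => Ideal.subset_span ⟨k, rfl⟩
  refine Ideal.span_le.2 ?_
  rintro p ((rfl | rfl) | ⟨k, -, rfl⟩)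
  · have := add_mem (h a) (h b)
    rw [SetLike.mem_coe]
    convert this using 1
    ring
  · have := add_mem (Ideal.mul_mem_left _ (yv b) (h a)) (Ideal.mul_mem_left _ (xv a) (h b))
    rw [SetLike.mem_coe]
    convert this using 1
    ring
  · exact h k

/-- The filtration of the black blob bimodule: everything in degrees `≤ 0`, the subbimodule
generated by `(y b - y a) - (x b - x a)` in degree `1`, and zero in degrees `≥ 2`. -/
def blobFil (a b : Fin n) (i : ℤ) : Ideal (Pxy n ⧸ blobIdeal a b) :=
  if i ≤ 0 then ⊤
  else if i = 1 then Ideal.span {Ideal.Quotient.mk _ ((yv b - yv a) - (xv b - xv a))}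
  else ⊥

/-- The trivial filtration of the bimodule of the identity braid. -/
def idFil (n : ℕ) (i : ℤ) : Ideal (Pxy n ⧸ idIdeal n) :=
  if i ≤ 0 then ⊤ else ⊥

theorem polyGr_internal (n : ℕ) : DirectSum.IsInternal (polyGr n) :=
  letI := MvPolynomial.weightedDecomposition ℚ (fun _ : Fin n ⊕ Fin n => (2 : ℤ))
  DirectSum.Decomposition.isInternal _

theorem mem_of_mem_span {G : Set (Pxy n)} (K : Submodule ℚ (Pxy n))
    (h : ∀ q, ∀ p ∈ polyGr n q, ∀ g ∈ G, p * g ∈ K) {z : Pxy n} (hz : z ∈ Ideal.span G) :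
    z ∈ K := by
  have h1 : ∀ g ∈ G, ∀ p : Pxy n, p * g ∈ K := by
    intro g hg
    have : (⊤ : Submodule ℚ (Pxy n)) ≤ K.comap (LinearMap.mulRight ℚ g) := by
      rw [← (polyGr_internal n).submodule_iSup_eq_top]
      exact iSup_le fun q p hp => h q p hp g hg
    exact fun p => this (Submodule.mem_top (x := p))
  have h2 : ∀ p : Pxy n, p * z ∈ K := by
    refine Submodule.span_induction (p := fun z _ => ∀ p : Pxy n, p * z ∈ K) ?_ ?_ ?_ ?_ hz
    · exact h1
    · intro p; simp
    · intro u v _ _ hu hv p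
      rw [mul_add]
      exact add_mem (hu p) (hv p)
    · intro c u _ hu p
      rw [smul_eq_mul, ← mul_assoc]
      exact hu _
  simpa using h2 1

theorem mul_mem_polyGr {p p' : Pxy n} {q q' : ℤ} (h : p ∈ polyGr n q) (h' : p' ∈ polyGr n q') :
    p * p' ∈ polyGr n (q + q') := by
  rw [MvPolynomial.mem_weightedHomogeneousSubmodule] at *
  exact h.mul h'

theorem X_mem_polyGr (k : Fin n ⊕ Fin n) : (MvPolynomial.X k : Pxy n) ∈ polyGr n 2 :=
  MvPolynomial.isWeightedHomogeneous_X ℚ _ k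

theorem quotGr_internal (G : Set (Pxy n)) (hG : ∀ g ∈ G, ∃ e, g ∈ polyGr n e) :
    DirectSum.IsInternal (quotGr (Ideal.span G)) := by
  refine isInternal_map _ (polyGr_internal n) _ (Ideal.Quotient.mkₐ_surjective ℚ _)
    fun φ hφ z hz => ?_
  have hz' : z ∈ Ideal.span G := Ideal.Quotient.eq_zero_iff_mem.1 hz
  refine mem_of_mem_span _ (fun q p hp g hg => ?_) hz'
  obtain ⟨e, he⟩ := hG g hg
  rw [LinearMap.mem_ker, hφ _ _ (mul_mem_polyGr hp he)]
  have : (Ideal.Quotient.mkₐ ℚ (Ideal.span G)).toLinearMap (p * g) = 0 :=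
    Ideal.Quotient.eq_zero_iff_mem.2 (Ideal.mul_mem_left _ _ (Ideal.subset_span hg))
  rw [this, Finsupp.single_zero]

theorem idIdeal_internal (n : ℕ) : DirectSum.IsInternal (quotGr (idIdeal n)) := by
  refine quotGr_internal _ ?_
  rintro _ ⟨k, rfl⟩
  exact ⟨2, sub_mem (X_mem_polyGr _) (X_mem_polyGr _)⟩

theorem blobIdeal_internal (a b : Fin n) : DirectSum.IsInternal (quotGr (blobIdeal a b)) := by
  refine quotGr_internal _ ?_
  rintro _ ((rfl | rfl) | ⟨k, -, rfl⟩)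
  · exact ⟨2, sub_mem (add_mem (X_mem_polyGr _) (X_mem_polyGr _))
      (add_mem (X_mem_polyGr _) (X_mem_polyGr _))⟩
  · exact ⟨2 + 2, sub_mem (mul_mem_polyGr (X_mem_polyGr _) (X_mem_polyGr _))
      (mul_mem_polyGr (X_mem_polyGr _) (X_mem_polyGr _))⟩
  · exact ⟨2, sub_mem (X_mem_polyGr _) (X_mem_polyGr _)⟩

theorem X_smul_mem_quotGr (I : Ideal (Pxy n)) (k : Fin n ⊕ Fin n) (q : ℤ) (m : Pxy n ⧸ I)
    (hm : m ∈ quotGr I q) : (MvPolynomial.X k : Pxy n) • m ∈ quotGr I (q + 2) := by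
  obtain ⟨p, hp, rfl⟩ := hm
  refine ⟨MvPolynomial.X k * p, ?_, rfl⟩
  rw [add_comm q 2]
  exact mul_mem_polyGr (X_mem_polyGr k) hp

theorem span_le_iSup_quotGr (I : Ideal (Pxy n)) {g : Pxy n} {e : ℤ} (hg : g ∈ polyGr n e) :
    (Ideal.span {Ideal.Quotient.mk I g}).restrictScalars ℚ ≤
      ⨆ q, (Ideal.span {Ideal.Quotient.mk I g}).restrictScalars ℚ ⊓ quotGr I q := by
  intro z hz
  obtain ⟨c, rfl⟩ := Ideal.mem_span_singleton'.1 hz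
  obtain ⟨p, rfl⟩ := Ideal.Quotient.mk_surjective c
  have := mem_of_mem_span (G := {g})
    ((⨆ q, (Ideal.span {Ideal.Quotient.mk I g}).restrictScalars ℚ ⊓ quotGr I q).comap
      (Ideal.Quotient.mkₐ ℚ I).toLinearMap) (fun q p hp g' hg' => ?_)
    (Ideal.mem_span_singleton'.2 ⟨p, rfl⟩)
  · simpa using this
  · rw [Set.mem_singleton_iff] at hg'
    subst hg'
    refine Submodule.mem_iSup_of_mem (q + e) ⟨?_, ⟨_, mul_mem_polyGr hp hg, rfl⟩⟩
    exact Ideal.mem_span_singleton'.2 ⟨Ideal.Quotient.mk I p, by simp⟩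

theorem blobFil_le (a b : Fin n) (i : ℤ) : (blobFil a b i).restrictScalars ℚ ≤
    ⨆ q, (blobFil a b i).restrictScalars ℚ ⊓ quotGr (blobIdeal a b) q := by
  have h1 := span_le_iSup_quotGr (blobIdeal a b) (g := 1) (e := 0)
    (MvPolynomial.isWeightedHomogeneous_one ℚ _)
  rw [map_one, Ideal.span_singleton_one] at h1
  unfold blobFil
  split_ifs
  · exact h1
  · exact span_le_iSup_quotGr _ (sub_mem (sub_mem (X_mem_polyGr _) (X_mem_polyGr _))
      (sub_mem (X_mem_polyGr _) (X_mem_polyGr _)))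
  · simp

theorem idFil_le (n : ℕ) (i : ℤ) : (idFil n i).restrictScalars ℚ ≤
    ⨆ q, (idFil n i).restrictScalars ℚ ⊓ quotGr (idIdeal n) q := by
  have h1 := span_le_iSup_quotGr (idIdeal n) (g := 1) (e := 0)
    (MvPolynomial.isWeightedHomogeneous_one ℚ _)
  rw [map_one, Ideal.span_singleton_one] at h1
  unfold idFil
  split_ifs
  · exact h1
  · simp

theorem blobFil_antitone (a b : Fin n) : Antitone (blobFil a b) := by
  intro i j hij
  unfold blobFil
  split_ifs <;> first | exact le_rfl | exact le_top | exact bot_le | omega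

theorem idFil_antitone (n : ℕ) : Antitone (idFil n) := by
  intro i j hij
  unfold idFil
  split_ifs <;> first | exact le_rfl | exact le_top | exact bot_le | omega

/-- The bigrading of the complex of a negative crossing: the blob bimodule is in homological
degree `1`, the identity bimodule in homological degree `0`. -/
def crossingGr (a b : Fin n) (c : ℤ × ℤ) :
    Submodule ℚ ((Pxy n ⧸ blobIdeal a b) × (Pxy n ⧸ idIdeal n)) :=
  (if c.1 = 1 then quotGr (blobIdeal a b) c.2 else ⊥).prod
    (if c.1 = 0 then quotGr (idIdeal n) c.2 else ⊥)

theorem mem_crossingGr_one (a b : Fin n) {q : ℤ} {m : Pxy n ⧸ blobIdeal a b}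
    (hm : m ∈ quotGr (blobIdeal a b) q) : (m, 0) ∈ crossingGr a b (1, q) := by
  simpa [crossingGr] using hm

theorem mem_crossingGr_zero (a b : Fin n) {q : ℤ} {m : Pxy n ⧸ idIdeal n}
    (hm : m ∈ quotGr (idIdeal n) q) : (0, m) ∈ crossingGr a b (0, q) := by
  simpa [crossingGr] using hm

theorem crossingGr_cases (a b : Fin n) {c : ℤ × ℤ}
    {m : (Pxy n ⧸ blobIdeal a b) × (Pxy n ⧸ idIdeal n)} (hm : m ∈ crossingGr a b c) :
    (c.1 = 1 ∧ m.1 ∈ quotGr (blobIdeal a b) c.2 ∧ m.2 = 0) ∨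
      (c.1 = 0 ∧ m.2 ∈ quotGr (idIdeal n) c.2 ∧ m.1 = 0) ∨ m = 0 := by
  obtain ⟨t, q⟩ := c
  obtain ⟨u, v⟩ := m
  rw [crossingGr, Submodule.mem_prod] at hm
  dsimp only at hm ⊢
  by_cases h1 : t = 1
  · simp_all
  · by_cases h0 : t = 0 <;> simp_all

theorem crossingGr_internal (a b : Fin n) : DirectSum.IsInternal (crossingGr a b) := by
  obtain ⟨Δ, hΔ⟩ := exists_splitting _ (blobIdeal_internal a b)
  obtain ⟨Δ', hΔ'⟩ := exists_splitting _ (idIdeal_internal n)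
  refine isInternal_of_splitting _ ?_
    (LinearMap.coprod
      (Finsupp.lmapDomain _ ℚ (fun q : ℤ => ((1, q) : ℤ × ℤ)) ∘ₗ
        Finsupp.mapRange.linearMap (LinearMap.inl ℚ _ _) ∘ₗ Δ)
      (Finsupp.lmapDomain _ ℚ (fun q : ℤ => ((0, q) : ℤ × ℤ)) ∘ₗ
        Finsupp.mapRange.linearMap (LinearMap.inr ℚ _ _) ∘ₗ Δ')) ?_
  · have h1 : (⊤ : Submodule ℚ (Pxy n ⧸ blobIdeal a b)) ≤
        (⨆ c, crossingGr a b c).comap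
          (LinearMap.inl ℚ (Pxy n ⧸ blobIdeal a b) (Pxy n ⧸ idIdeal n)) := by
      rw [← (blobIdeal_internal a b).submodule_iSup_eq_top]
      exact iSup_le fun q m hm => Submodule.mem_iSup_of_mem (1, q) (mem_crossingGr_one a b hm)
    have h2 : (⊤ : Submodule ℚ (Pxy n ⧸ idIdeal n)) ≤
        (⨆ c, crossingGr a b c).comap
          (LinearMap.inr ℚ (Pxy n ⧸ blobIdeal a b) (Pxy n ⧸ idIdeal n)) := by
      rw [← (idIdeal_internal n).submodule_iSup_eq_top]
      exact iSup_le fun q m hm => Submodule.mem_iSup_of_mem (0, q) (mem_crossingGr_zero a b hm)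
    rw [eq_top_iff]
    rintro ⟨u, v⟩ -
    exact mk_mem_of_mem (h1 (Submodule.mem_top (x := u))) (h2 (Submodule.mem_top (x := v)))
  · rintro ⟨t, q⟩ ⟨u, v⟩ hm
    rcases crossingGr_cases a b hm with ⟨h, hu, hv⟩ | ⟨h, hv, hu⟩ | h
    · dsimp only at h hu hv
      subst h hv
      simp [hΔ q u hu, Finsupp.mapDomain_single]
    · dsimp only at h hu hv
      subst h hu
      simp [hΔ' q v hv, Finsupp.mapDomain_single]
    · rw [h]; simp

/-- The map from the blob bimodule to the identity bimodule that sends `1` to `1`. -/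
def chiMinus (a b : Fin n) : (Pxy n ⧸ blobIdeal a b) →ₗ[Pxy n] (Pxy n ⧸ idIdeal n) :=
  (Ideal.Quotient.factorₐ (Pxy n) (blobIdeal_le_idIdeal a b)).toLinearMap

/-- The differential `(u, v) ↦ (0, chiMinus u)` of the complex of a negative crossing. -/
def crossingD (a b : Fin n) : ((Pxy n ⧸ blobIdeal a b) × (Pxy n ⧸ idIdeal n)) →ₗ[Pxy n]
    ((Pxy n ⧸ blobIdeal a b) × (Pxy n ⧸ idIdeal n)) :=
  (LinearMap.inr (Pxy n) (Pxy n ⧸ blobIdeal a b) (Pxy n ⧸ idIdeal n) ∘ₗ chiMinus a b) ∘ₗ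
    LinearMap.fst (Pxy n) (Pxy n ⧸ blobIdeal a b) (Pxy n ⧸ idIdeal n)

theorem X_smul_mem_crossingGr (a b : Fin n) (k : Fin n ⊕ Fin n) (c : ℤ × ℤ)
    (m : (Pxy n ⧸ blobIdeal a b) × (Pxy n ⧸ idIdeal n)) (hm : m ∈ crossingGr a b c) :
    (MvPolynomial.X k : Pxy n) • m ∈ crossingGr a b (c + (0, 2)) := by
  obtain ⟨t, q⟩ := c
  obtain ⟨u, v⟩ := m
  rcases crossingGr_cases a b hm with ⟨h, hu, hv⟩ | ⟨h, hv, hu⟩ | h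
  · dsimp only at h hu hv
    subst h hv
    simpa using mem_crossingGr_one a b (X_smul_mem_quotGr _ k q u hu)
  · dsimp only at h hu hv
    subst h hu
    simpa using mem_crossingGr_zero a b (X_smul_mem_quotGr _ k q v hv)
  · rw [h, smul_zero]
    exact zero_mem _

theorem crossingD_mem (a b : Fin n) (c : ℤ × ℤ)
    (m : (Pxy n ⧸ blobIdeal a b) × (Pxy n ⧸ idIdeal n)) (hm : m ∈ crossingGr a b c) :
    crossingD a b m ∈ crossingGr a b (c + (-1, 0)) := by
  obtain ⟨t, q⟩ := c
  obtain ⟨u, v⟩ := m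
  rcases crossingGr_cases a b hm with ⟨h, hu, hv⟩ | ⟨h, hv, hu⟩ | h
  · dsimp only at h hu hv
    subst h hv
    obtain ⟨p, hp, rfl⟩ := hu
    have := mem_crossingGr_zero a b (q := q) (m := Ideal.Quotient.mk _ p) ⟨p, hp, rfl⟩
    simpa [crossingD, chiMinus] using this
  · dsimp only at h hu hv
    subst h hu
    simp only [crossingD, LinearMap.comp_apply, LinearMap.fst_apply, map_zero]
    exact zero_mem _
  · rw [h, map_zero]
    exact zero_mem _

theorem chiMinus_mem (a b : Fin n) (i : ℤ) (m : Pxy n ⧸ blobIdeal a b) (hm : m ∈ blobFil a b i) :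
    chiMinus a b m ∈ idFil n i := by
  unfold idFil
  split_ifs with h0
  · trivial
  · have h1 := blobFil_antitone a b (show 1 ≤ i by omega) hm
    simp only [blobFil, if_true, show ¬ ((1 : ℤ) ≤ 0) by omega, if_false] at h1
    obtain ⟨c, rfl⟩ := Ideal.mem_span_singleton'.1 h1
    obtain ⟨p, rfl⟩ := Ideal.Quotient.mk_surjective c
    rw [Ideal.mem_bot]
    have h : ∀ k, yv k - xv k ∈ idIdeal n := fun k => Ideal.subset_span ⟨k, rfl⟩
    have h2 : p * ((yv b - yv a) - (xv b - xv a)) ∈ idIdeal n := by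
      have := Ideal.mul_mem_left _ p (sub_mem (h b) (h a))
      convert this using 2
      ring
    rw [← map_mul]
    exact Ideal.Quotient.eq_zero_iff_mem.2 h2

/-- The complex `blob → identity` of the negative crossing of the strands `a` and `b`. -/
def negCrossing (a b : Fin n) : FilteredComplex n where
  M := (Pxy n ⧸ blobIdeal a b) × (Pxy n ⧸ idIdeal n)
  l := (Algebra.lsmul ℚ ℚ _).comp (MvPolynomial.rename (Sum.inr : Fin n → Fin n ⊕ Fin n))
  r := (Algebra.lsmul ℚ ℚ _).comp (MvPolynomial.rename (Sum.inl : Fin n → Fin n ⊕ Fin n))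
  l_r := fun p q m => smul_comm _ _ m
  gr := crossingGr a b
  gr_internal := crossingGr_internal a b
  gr_l := fun k c m hm => by
    simpa using X_smul_mem_crossingGr a b (Sum.inr k) c m hm
  gr_r := fun k c m hm => by
    simpa using X_smul_mem_crossingGr a b (Sum.inl k) c m hm
  d := (crossingD a b).restrictScalars ℚ
  d_l := fun p m => map_smul (crossingD a b) _ m
  d_r := fun p m => map_smul (crossingD a b) _ m
  d_gr := crossingD_mem a b
  d_d := fun m => by simp [crossingD]
  fil := fun i => ((blobFil a b i).restrictScalars ℚ).prod ((idFil n i).restrictScalars ℚ)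
  fil_antitone := fun i j hij m hm =>
    ⟨blobFil_antitone a b hij hm.1, idFil_antitone n hij hm.2⟩
  fil_l := fun i p m hm => ⟨Submodule.smul_mem (blobFil a b i) (Ideal.Quotient.mk _ _) hm.1,
    Submodule.smul_mem (idFil n i) (Ideal.Quotient.mk _ _) hm.2⟩
  fil_r := fun i p m hm => ⟨Submodule.smul_mem (blobFil a b i) (Ideal.Quotient.mk _ _) hm.1,
    Submodule.smul_mem (idFil n i) (Ideal.Quotient.mk _ _) hm.2⟩
  fil_d := fun i m hm => ⟨zero_mem (blobFil a b i), chiMinus_mem a b i m.1 hm.1⟩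
  fil_gr := by
    rintro i ⟨u, v⟩ ⟨hu, hv⟩
    have h1 : (blobFil a b i).restrictScalars ℚ ≤
        (⨆ c, (((blobFil a b i).restrictScalars ℚ).prod ((idFil n i).restrictScalars ℚ)) ⊓
          crossingGr a b c).comap
          (LinearMap.inl ℚ (Pxy n ⧸ blobIdeal a b) (Pxy n ⧸ idIdeal n)) :=
      (blobFil_le a b i).trans (iSup_le fun q m hm => Submodule.mem_iSup_of_mem (1, q)
        ⟨⟨hm.1, zero_mem _⟩, mem_crossingGr_one a b hm.2⟩)
    have h2 : (idFil n i).restrictScalars ℚ ≤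
        (⨆ c, (((blobFil a b i).restrictScalars ℚ).prod ((idFil n i).restrictScalars ℚ)) ⊓
          crossingGr a b c).comap
          (LinearMap.inr ℚ (Pxy n ⧸ blobIdeal a b) (Pxy n ⧸ idIdeal n)) :=
      (idFil_le n i).trans (iSup_le fun q m hm => Submodule.mem_iSup_of_mem (0, q)
        ⟨⟨zero_mem _, hm.1⟩, mem_crossingGr_zero a b hm.2⟩)
    exact mk_mem_of_mem (h1 hu) (h2 hv)
  fil_top := ⟨0, by simp [blobFil, idFil]⟩
  fil_bot := ⟨2, by simp [blobFil, idFil]⟩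

end FilteredComplex

/-- The filtered complex of the negative elementary braid `σᵢ⁻¹` on `m + 1` strands, with strands
and generators numbered from `0`: `σᵢ` crosses the strands `i` and `i + 1`. -/
def sigmaInv {m : ℕ} (i : Fin m) : FilteredComplex (m + 1) :=
  FilteredComplex.negCrossing i.castSucc i.succ

end FilteredRouquier

end

/-!
The two sides are tensor products `C ⊗ D ⊗ C` and `D ⊗ C ⊗ D`, where `C` and `D` are the complexes
`B → 1` of crossings of the strands `a, b` and `b, c`. Both are cubes with eight vertices, and both
contract to the same complex. In `C ⊗ D ⊗ C` the bimodule `B ⊗ B` of the two outer factors is a sum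
of two copies of `B`, generated by `1 ⊗ 1` and by its multiple by `t`, the variable on the strand
`a` between the two factors; Gaussian elimination cancels the second copy against a part of the
triple product `B ⊗ B ⊗ B`, and the first one against one of the two copies of `B` in homological
degree one. What remains is symmetric under the exchange of the two crossings, and in its highest
degree is the bimodule generated by one element on which symmetric polynomials in the three
variables act equally from both sides. Composing one contraction with the inverse of the other gives
explicit maps `braidVal` in both directions and explicit homotopies `homotopyVal`.

All maps are given by values on ten generators (`genFamily`): one for each vertex of the cube, and
two more, multiples by `t`, for the vertices at which both outer factors are `B`. The relations
between these generators say how the variables `x` and `y` compare on each of them, and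
`exists_lift` shows that values subject to the same relations (`GenRel`) extend to a map of
bimodules. The identities between these maps (`braidMap_d`, `braidMap_comp`) are then checked on the
generators. This uses only the properties of the two factors collected in `Crossing`, which are
symmetric in the two strands, so that the map in the other direction is the same construction with
the roles of the crossings exchanged.

The statement on filtrations holds for every map of bimodules `f` between the two sides
(`violates_two`). Filtration zero is everything, which leaves only the steps from three on. The pure
tensors that span filtration three vanish unless each factor is in filtration one, and on the middle
factor filtration one consists of the multiples of `y c - x c`, which acts as zero on the outer
factors. So filtration three consists of multiples of `y c - x c`; these go to such multiples, and
on the other side every multiple of `y c - x c` is in filtration one. Filtration four is zero.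
-/

open scoped TensorProduct

noncomputable section

namespace FilteredRouquier
namespace FilteredComplex

variable {n : ℕ}
/-! ### Bimodules as modules over the polynomial ring in two sets of variables -/

/-- The action of `ℚ[x, y]` on a complex of bimodules: `y` acts by `l` and `x` by `r`. -/
def act (C : FilteredComplex n) : Pxy n →ₐ[ℚ] Module.End ℚ C.M :=
  (Algebra.TensorProduct.lift C.l C.r
    (fun p q => LinearMap.ext fun m => C.l_r p q m)).comp
    (MvPolynomial.aeval (Sum.elim (fun k => 1 ⊗ₜ MvPolynomial.X k)
      (fun k => MvPolynomial.X k ⊗ₜ 1)))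

instance instModulePxy (C : FilteredComplex n) : Module (Pxy n) C.M :=
  Module.compHom C.M C.act.toRingHom

theorem smul_def (C : FilteredComplex n) (p : Pxy n) (m : C.M) : p • m = C.act p m := rfl

instance (C : FilteredComplex n) : IsScalarTower ℚ (Pxy n) C.M :=
  ⟨fun c p m => by simp [smul_def]⟩

@[simp]
theorem act_yv (C : FilteredComplex n) (k : Fin n) :
    C.act (yv k) = C.l (MvPolynomial.X k) := by
  rw [act, AlgHom.comp_apply, MvPolynomial.aeval_X]
  exact (Algebra.TensorProduct.lift_tmul _ _ _ _ _).trans (by simp)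

@[simp]
theorem act_xv (C : FilteredComplex n) (k : Fin n) :
    C.act (xv k) = C.r (MvPolynomial.X k) := by
  rw [act, AlgHom.comp_apply, MvPolynomial.aeval_X]
  exact (Algebra.TensorProduct.lift_tmul _ _ _ _ _).trans (by simp)

theorem yv_smul (C : FilteredComplex n) (k : Fin n) (m : C.M) :
    yv k • m = C.l (MvPolynomial.X k) m := by
  simp [smul_def]

theorem xv_smul (C : FilteredComplex n) (k : Fin n) (m : C.M) :
    xv k • m = C.r (MvPolynomial.X k) m := by
  simp [smul_def]

theorem rename_inr_smul (C : FilteredComplex n) (p : MvPolynomial (Fin n) ℚ) (m : C.M) :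
    (MvPolynomial.rename Sum.inr p : Pxy n) • m = C.l p m := by
  have : C.act.comp (MvPolynomial.rename Sum.inr) = C.l := by
    refine MvPolynomial.algHom_ext fun k => ?_
    simp
  exact LinearMap.congr_fun (DFunLike.congr_fun this p) m

theorem rename_inl_smul (C : FilteredComplex n) (p : MvPolynomial (Fin n) ℚ) (m : C.M) :
    (MvPolynomial.rename Sum.inl p : Pxy n) • m = C.r p m := by
  have : C.act.comp (MvPolynomial.rename Sum.inl) = C.r := by
    refine MvPolynomial.algHom_ext fun k => ?_
    simp
  exact LinearMap.congr_fun (DFunLike.congr_fun this p) m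

/-- A `ℚ`-linear map that commutes with each of the variables is linear over `ℚ[x, y]`. -/
def polyLinear {V W : Type} [AddCommGroup V] [Module ℚ V] [AddCommGroup W] [Module ℚ W]
    [Module (Pxy n) V] [IsScalarTower ℚ (Pxy n) V] [Module (Pxy n) W]
    [IsScalarTower ℚ (Pxy n) W] (f : V →ₗ[ℚ] W)
    (hx : ∀ k m, f ((xv k : Pxy n) • m) = (xv k : Pxy n) • f m)
    (hy : ∀ k m, f ((yv k : Pxy n) • m) = (yv k : Pxy n) • f m) :
    V →ₗ[Pxy n] W where
  toFun := f
  map_add' := f.map_add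
  map_smul' p m := by
    induction p using MvPolynomial.induction_on generalizing m with
    | C a =>
      have : (MvPolynomial.C a : Pxy n) = a • 1 := by
        rw [MvPolynomial.smul_eq_C_mul, mul_one]
      simp [this, smul_assoc]
    | add p q hp hq => simpa [add_smul] using congrArg₂ (· + ·) (hp m) (hq m)
    | mul_X p k hp =>
      rcases k with k | k
      · simpa [mul_smul, hx] using hp (xv k • m)
      · simpa [mul_smul, hy] using hp (yv k • m)

@[simp]
theorem polyLinear_apply {V W : Type} [AddCommGroup V] [Module ℚ V] [AddCommGroup W]
    [Module ℚ W] [Module (Pxy n) V] [IsScalarTower ℚ (Pxy n) V] [Module (Pxy n) W]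
    [IsScalarTower ℚ (Pxy n) W] (f : V →ₗ[ℚ] W)
    (hx : ∀ k m, f ((xv k : Pxy n) • m) = (xv k : Pxy n) • f m)
    (hy : ∀ k m, f ((yv k : Pxy n) • m) = (yv k : Pxy n) • f m) (m : V) :
    polyLinear f hx hy m = f m := rfl

theorem isBimoduleMap_restrictScalars {C D : FilteredComplex n} (f : C.M →ₗ[Pxy n] D.M) :
    IsBimoduleMap (f.restrictScalars ℚ) :=
  ⟨fun p m => by simp [← rename_inr_smul], fun p m => by simp [← rename_inl_smul]⟩

/-- The differential as a map of `ℚ[x, y]`-modules. -/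
def dP (C : FilteredComplex n) : C.M →ₗ[Pxy n] C.M :=
  polyLinear C.d (fun k m => by simp [xv_smul, C.d_r]) (fun k m => by simp [yv_smul, C.d_l])

@[simp]
theorem dP_apply (C : FilteredComplex n) (m : C.M) : C.dP m = C.d m := rfl

theorem smul_mem_gr (C : FilteredComplex n) {q : ℤ} {p : Pxy n} (hp : p ∈ polyGr n q)
    {c : ℤ × ℤ} {m : C.M} (hm : m ∈ C.gr c) : p • m ∈ C.gr (c + (0, q)) := by
  have hmon : ∀ (s : (Fin n ⊕ Fin n) →₀ ℕ) (c : ℤ × ℤ) (m : C.M), m ∈ C.gr c →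
      MvPolynomial.monomial s (1 : ℚ) • m ∈
        C.gr (c + (0, Finsupp.weight (fun _ => (2 : ℤ)) s)) := by
    intro s
    induction s using Finsupp.induction_linear with
    | zero => intro c m hm; convert hm using 2 <;> simp [← MvPolynomial.C_apply]
    | add s t hs ht =>
      intro c m hm
      have h := hs _ _ (ht _ _ hm)
      rw [← mul_smul, MvPolynomial.monomial_mul, mul_one] at h
      convert h using 2
      refine Prod.ext (by simp) ?_
      simp only [Prod.snd_add, map_add]
      ring
    | single k e =>
      induction e with
      | zero => intro c m hm; convert hm using 2 <;> simp [← MvPolynomial.C_apply]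
      | succ e ih =>
        intro c m hm
        have h : (MvPolynomial.X k : Pxy n) •
            (MvPolynomial.monomial (Finsupp.single k e) (1 : ℚ) • m) ∈
              C.gr (c + (0, Finsupp.weight (fun _ => (2 : ℤ)) (Finsupp.single k e)) + (0, 2)) := by
          rcases k with k | k
          · rw [xv_smul]; exact C.gr_r _ _ _ (ih c m hm)
          · rw [yv_smul]; exact C.gr_l _ _ _ (ih c m hm)
        rw [← mul_smul, MvPolynomial.X, MvPolynomial.monomial_mul, mul_one, ← Finsupp.single_add,
          add_comm 1 e] at h
        convert h using 2
        rw [add_assoc, Finsupp.single_add, map_add]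
        simp [Finsupp.weight_single]
  rw [p.as_sum, Finset.sum_smul]
  refine Submodule.sum_mem _ fun s hs => ?_
  have hq := hp (MvPolynomial.mem_support_iff.1 hs)
  rw [← mul_one (MvPolynomial.coeff s p), ← smul_eq_mul, ← MvPolynomial.smul_monomial, smul_assoc,
    ← hq]
  exact Submodule.smul_mem _ _ (hmon s c m hm)

/-- Homogeneous generators over `ℚ[x, y]` generate homogeneously, so that the degree of a map of
`ℚ[x, y]`-modules can be read off from its values on such generators. -/
theorem hasDegree_of_generators {C D : FilteredComplex n} {ι : Type} (v : ι → C.M)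
    (deg : ι → ℤ × ℤ) (hv : ∀ k, v k ∈ C.gr (deg k))
    (hspan : Submodule.span (Pxy n) (Set.range v) = ⊤) (t : ℤ) (f : C.M →ₗ[Pxy n] D.M)
    (hf : ∀ k, f (v k) ∈ D.gr (deg k + (t, 0))) : HasDegree t (f.restrictScalars ℚ) := by
  -- the part of degree `c` that the homogeneous multiples of the generators span
  let Q : ℤ × ℤ → Submodule ℚ C.M := fun c =>
    Submodule.span ℚ {m | ∃ k q, ∃ p ∈ polyGr n q, deg k + (0, q) = c ∧ m = p • v k}
  have hQf : ∀ c, Q c ≤ (D.gr (c + (t, 0))).comap (f.restrictScalars ℚ) := by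
    intro c
    refine Submodule.span_le.2 ?_
    rintro _ ⟨k, q, p, hp, rfl, rfl⟩
    have := D.smul_mem_gr hp (hf k)
    rw [SetLike.mem_coe, Submodule.mem_comap, LinearMap.restrictScalars_apply, map_smul]
    convert this using 2
    abel
  have hQ : ∀ c, Q c ≤ C.gr c := by
    intro c
    refine Submodule.span_le.2 ?_
    rintro _ ⟨k, q, p, hp, rfl, rfl⟩
    exact C.smul_mem_gr hp (hv k)
  have hpv : ∀ k (p : Pxy n), p • v k ∈ ⨆ c, Q c := by
    intro k p
    have : (⊤ : Submodule ℚ (Pxy n)) ≤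
        (⨆ c, Q c).comap ((LinearMap.toSpanSingleton (Pxy n) C.M (v k)).restrictScalars ℚ) := by
      rw [← (polyGr_internal n).submodule_iSup_eq_top]
      exact iSup_le fun q p hp => Submodule.mem_iSup_of_mem (deg k + (0, q))
        (Submodule.subset_span ⟨k, q, p, hp, rfl, rfl⟩)
    exact this (Submodule.mem_top (x := p))
  have htop : ∀ m : C.M, m ∈ ⨆ c, Q c := by
    intro m
    have hm : m ∈ Submodule.span (Pxy n) (Set.range v) := hspan ▸ Submodule.mem_top
    obtain ⟨c, rfl⟩ := (Finsupp.mem_span_range_iff_exists_finsupp).1 hm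
    exact Submodule.sum_mem _ fun k _ => hpv k (c k)
  obtain ⟨Δ, hΔ⟩ := exists_splitting C.gr C.gr_internal
  intro a m hm
  have h1 : (⨆ c, Q c) ≤ (Q a).comap ((Finsupp.lapply a) ∘ₗ Δ) := by
    refine iSup_le fun c m hm => ?_
    rw [Submodule.mem_comap, LinearMap.comp_apply, hΔ c m (hQ c hm), Finsupp.lapply_apply,
      Finsupp.single_apply]
    split_ifs with h
    · exact h ▸ hm
    · exact zero_mem _
  have h2 := h1 (htop m)
  rw [Submodule.mem_comap, LinearMap.comp_apply, hΔ a m hm, Finsupp.lapply_apply,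
    Finsupp.single_eq_same] at h2
  exact hQf a h2

/-! ### Pure tensors -/

/-- The class of `m ⊗ m'` in the tensor product of two complexes of bimodules. -/
def tmk (C D : FilteredComplex n) (m : C.M) (m' : D.M) : (C.tensor D).M :=
  (rel C D).mkQ (m ⊗ₜ m')

section Tensor

variable {C D : FilteredComplex n}

theorem tmk_add_left (m₁ m₂ : C.M) (m' : D.M) :
    tmk C D (m₁ + m₂) m' = tmk C D m₁ m' + tmk C D m₂ m' := by
  rw [tmk, TensorProduct.add_tmul, map_add]; rfl

theorem tmk_add_right (m : C.M) (m₁ m₂ : D.M) :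
    tmk C D m (m₁ + m₂) = tmk C D m m₁ + tmk C D m m₂ := by
  rw [tmk, TensorProduct.tmul_add, map_add]; rfl

theorem tmk_smul_left (c : ℚ) (m : C.M) (m' : D.M) : tmk C D (c • m) m' = c • tmk C D m m' := by
  rw [tmk, ← TensorProduct.smul_tmul', map_smul]; rfl

theorem tmk_smul_right (c : ℚ) (m : C.M) (m' : D.M) : tmk C D m (c • m') = c • tmk C D m m' := by
  rw [tmk, TensorProduct.tmul_smul, map_smul]; rfl

theorem tmk_zero_left (m' : D.M) : tmk C D 0 m' = 0 := by
  rw [← zero_smul ℚ (0 : C.M), tmk_smul_left, zero_smul]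

theorem tmk_zero_right (m : C.M) : tmk C D m 0 = 0 := by
  rw [← zero_smul ℚ (0 : D.M), tmk_smul_right, zero_smul]

theorem yv_smul_tmk (k : Fin n) (m : C.M) (m' : D.M) :
    (yv k : Pxy n) • tmk C D m m' = tmk C D (yv k • m) m' := by
  rw [yv_smul, yv_smul]
  exact tensorEnd_apply C D _ _ (C.l_r _) (fun _ _ => rfl) m m'

theorem xv_smul_tmk (k : Fin n) (m : C.M) (m' : D.M) :
    (xv k : Pxy n) • tmk C D m m' = tmk C D m (xv k • m') := by
  rw [xv_smul, xv_smul]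
  exact tensorEnd_apply C D _ _ (fun _ _ => rfl) (fun q m => (D.l_r q _ m).symm) m m'

theorem xv_smul_tmk_left (k : Fin n) (m : C.M) (m' : D.M) :
    tmk C D (xv k • m) m' = tmk C D m (yv k • m') := by
  rw [xv_smul, yv_smul]
  exact (Submodule.Quotient.eq _).2 (Submodule.subset_span ⟨_, _, _, rfl⟩)

theorem d_tmk (m : C.M) (m' : D.M) :
    (C.tensor D).d (tmk C D m m') = tmk C D (C.d m) m' + tmk C D (C.sgn m) (D.d m') := by
  change tensorD C D ((rel C D).mkQ (m ⊗ₜ m')) = _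
  rw [tensorD, LinearMap.add_apply, tensorEnd_apply, tensorEnd_apply]
  rfl

theorem tmk_mem_gr {a b c : ℤ × ℤ} (h : a + b = c) {m : C.M} {m' : D.M} (hm : m ∈ C.gr a)
    (hm' : m' ∈ D.gr b) : tmk C D m m' ∈ (C.tensor D).gr c :=
  ⟨_, tmul_mem_conv h hm hm', rfl⟩

theorem tmk_mem_fil {a b c : ℤ} (h : a + b = c) {m : C.M} {m' : D.M} (hm : m ∈ C.fil a)
    (hm' : m' ∈ D.fil b) : tmk C D m m' ∈ (C.tensor D).fil c :=
  ⟨_, tmul_mem_conv h hm hm', rfl⟩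

theorem tensor_fil_le {c : ℤ} {K : Submodule ℚ (C.tensor D).M}
    (h : ∀ a b, a + b = c → ∀ m ∈ C.fil a, ∀ m' ∈ D.fil b, tmk C D m m' ∈ K) :
    (C.tensor D).fil c ≤ K := by
  rintro _ ⟨x, hx, rfl⟩
  exact conv_le (K := K.comap (rel C D).mkQ) h hx

@[elab_as_elim]
theorem tensor_induction {p : (C.tensor D).M → Prop} (x : (C.tensor D).M) (zero : p 0)
    (add : ∀ x y, p x → p y → p (x + y)) (tmk : ∀ m m', p (tmk C D m m')) : p x := by
  obtain ⟨x, rfl⟩ := Submodule.mkQ_surjective _ x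
  induction x using TensorProduct.induction_on with
  | zero => rw [map_zero]; exact zero
  | tmul m m' => exact tmk m m'
  | add x y hx hy => rw [map_add]; exact add _ _ hx hy

/-- The map out of a tensor product that is induced by a balanced bilinear map. -/
def tensorLift {N : Type} [AddCommGroup N] [Module ℚ N] (B : C.M →ₗ[ℚ] D.M →ₗ[ℚ] N)
    (hB : ∀ (k : Fin n) (m : C.M) (m' : D.M),
      B ((xv k : Pxy n) • m) m' = B m ((yv k : Pxy n) • m')) : (C.tensor D).M →ₗ[ℚ] N :=
  (rel C D).liftQ (TensorProduct.lift B) (rel_le_ker C D _ fun k a b m _ m' _ => by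
    rw [TensorProduct.lift.tmul, TensorProduct.lift.tmul, ← xv_smul, ← yv_smul, hB])

/-- The bilinear map `(m, m') ↦ m ⊗ g m'`. -/
def tmkComp (C : FilteredComplex n) (g : D.M →ₗ[Pxy n] D.M) :
    C.M →ₗ[ℚ] D.M →ₗ[ℚ] (C.tensor D).M :=
  LinearMap.mk₂ ℚ (fun m m' => tmk C D m (g m'))
    (fun m₁ m₂ m' => tmk_add_left m₁ m₂ (g m')) (fun c m m' => tmk_smul_left c m (g m'))
    (fun m m₁ m₂ => by rw [map_add, tmk_add_right])
    (fun c m m' => by rw [LinearMap.map_smul_of_tower, tmk_smul_right])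

theorem tmkComp_balanced (C : FilteredComplex n) (g : D.M →ₗ[Pxy n] D.M) (k : Fin n) (m : C.M)
    (m' : D.M) : tmkComp C g ((xv k : Pxy n) • m) m' = tmkComp C g m ((yv k : Pxy n) • m') := by
  simp only [tmkComp, LinearMap.mk₂_apply, xv_smul_tmk_left, map_smul]

/-- The endomorphism `1 ⊗ g` of a tensor product. -/
def idTensor (C : FilteredComplex n) (g : D.M →ₗ[Pxy n] D.M) :
    (C.tensor D).M →ₗ[Pxy n] (C.tensor D).M :=
  have H : ∀ m m', tensorLift (tmkComp C g) (tmkComp_balanced C g) (tmk C D m m') =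
      tmk C D m (g m') := fun _ _ => rfl
  polyLinear (tensorLift (tmkComp C g) (tmkComp_balanced C g))
    (fun k x => by
      induction x using tensor_induction with
      | zero => simp only [smul_zero, map_zero]
      | add x y hx hy => simp only [smul_add, map_add, hx, hy]
      | tmk m m' => rw [xv_smul_tmk, H, H, xv_smul_tmk, map_smul])
    (fun k x => by
      induction x using tensor_induction with
      | zero => simp only [smul_zero, map_zero]
      | add x y hx hy => simp only [smul_add, map_add, hx, hy]
      | tmk m m' => rw [yv_smul_tmk, H, H, yv_smul_tmk])

@[simp]
theorem idTensor_tmk (g : D.M →ₗ[Pxy n] D.M) (m : C.M) (m' : D.M) :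
    idTensor C g (tmk C D m m') = tmk C D m (g m') := rfl

theorem d_idTensor (g : D.M →ₗ[Pxy n] D.M) (hg : ∀ m, D.d (g m) = g (D.d m))
    (x : (C.tensor D).M) : (C.tensor D).d (idTensor C g x) = idTensor C g ((C.tensor D).d x) := by
  induction x using tensor_induction with
  | zero => simp only [map_zero]
  | add x y hx hy => simp only [map_add, hx, hy]
  | tmk m m' => simp only [idTensor_tmk, d_tmk, map_add, hg]

end Tensor

/-! ### Complexes of a single crossing -/

theorem blobIdeal_comm (a b : Fin n) : blobIdeal a b = blobIdeal b a := by
  unfold blobIdeal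
  congr 2
  · rw [add_comm (yv a), add_comm (xv a), mul_comm (yv a), mul_comm (xv a)]
  · ext k; simp [and_comm]

/-- The ideals that cut out the blob bimodule and the identity bimodule. -/
def crossIdeal (a b : Fin n) : Bool → Ideal (Pxy n)
  | true => blobIdeal a b
  | false => idIdeal n

theorem crossIdeal_comm (a b : Fin n) (ε : Bool) : crossIdeal a b ε = crossIdeal b a ε := by
  cases ε
  · rfl
  · exact blobIdeal_comm a b

/-- What the argument uses of the complex `blob → identity` of a crossing of the strands `a` and
`b`: the generators `e true` of the blob bimodule and `e false` of the identity bimodule, the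
projections `κ` to the two cyclic summands, and the size of the filtration. In contrast to
`negCrossing a b`, this is symmetric in the two strands. -/
structure Crossing (C : FilteredComplex n) (a b : Fin n) where
  e : Bool → C.M
  κ : ∀ ε, C.M →ₗ[Pxy n] Pxy n ⧸ crossIdeal a b ε
  κ_same : ∀ ε, κ ε (e ε) = 1
  κ_ne : ∀ ε δ, ε ≠ δ → κ ε (e δ) = 0
  exists_eq : ∀ m, ∃ p q : Pxy n, m = p • e true + q • e false
  ann : ∀ ε, ∀ p ∈ crossIdeal a b ε, p • e ε = 0
  gr_true : e true ∈ C.gr (1, 0)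
  gr_false : e false ∈ C.gr (0, 0)
  d_true : C.d (e true) = e false
  d_false : C.d (e false) = 0
  fil_zero : C.fil 0 = ⊤
  fil_two : C.fil 2 = ⊥
  sub_smul_mem_fil : ∀ (k : Fin n) (m : C.M), (yv k - xv k : Pxy n) • m ∈ C.fil 1
  exists_of_mem_fil : ∀ k, k = a ∨ k = b → ∀ m ∈ C.fil 1, ∃ m', m = (yv k - xv k : Pxy n) • m'

namespace Crossing

variable {C : FilteredComplex n} {a b : Fin n}

/-- Exchanging the names of the two strands. -/
def symm (X : Crossing C a b) : Crossing C b a where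
  e := X.e
  κ ε := (Submodule.factor (crossIdeal_comm a b ε).le) ∘ₗ X.κ ε
  κ_same ε := by rw [LinearMap.comp_apply, X.κ_same]; rfl
  κ_ne ε δ h := by rw [LinearMap.comp_apply, X.κ_ne ε δ h, map_zero]
  exists_eq := X.exists_eq
  ann ε p hp := X.ann ε p (crossIdeal_comm b a ε ▸ hp)
  gr_true := X.gr_true
  gr_false := X.gr_false
  d_true := X.d_true
  d_false := X.d_false
  fil_zero := X.fil_zero
  fil_two := X.fil_two
  sub_smul_mem_fil := X.sub_smul_mem_fil
  exists_of_mem_fil k hk := X.exists_of_mem_fil k hk.symm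

theorem smul_eq_zero_of_mem (X : Crossing C a b) {p : Pxy n} (hp : p ∈ blobIdeal a b) (m : C.M) :
    p • m = 0 := by
  obtain ⟨q, r, rfl⟩ := X.exists_eq m
  rw [smul_add, smul_comm p q, smul_comm p r, X.ann true p hp,
    X.ann false p (blobIdeal_le_idIdeal a b hp), smul_zero, smul_zero, add_zero]

theorem add_smul_eq (X : Crossing C a b) (m : C.M) :
    (yv a + yv b : Pxy n) • m = (xv a + xv b : Pxy n) • m := by
  rw [← sub_eq_zero, ← sub_smul]
  exact X.smul_eq_zero_of_mem (Ideal.subset_span (by simp)) m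

theorem mul_smul_eq (X : Crossing C a b) (m : C.M) :
    (yv a * yv b : Pxy n) • m = (xv a * xv b : Pxy n) • m := by
  rw [← sub_eq_zero, ← sub_smul]
  exact X.smul_eq_zero_of_mem (Ideal.subset_span (by simp)) m

theorem smul_eq (X : Crossing C a b) {k : Fin n} (ha : k ≠ a) (hb : k ≠ b) (m : C.M) :
    (yv k : Pxy n) • m = (xv k : Pxy n) • m := by
  rw [← sub_eq_zero, ← sub_smul]
  exact X.smul_eq_zero_of_mem (Ideal.subset_span (Or.inr ⟨k, ⟨ha, hb⟩, rfl⟩)) m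

theorem smul_false (X : Crossing C a b) (k : Fin n) :
    (yv k : Pxy n) • X.e false = (xv k : Pxy n) • X.e false := by
  rw [← sub_eq_zero, ← sub_smul]
  exact X.ann false _ (Ideal.subset_span ⟨k, rfl⟩)

theorem sgn_true (X : Crossing C a b) : C.sgn (X.e true) = - X.e true := by
  rw [C.sgn_apply X.gr_true]; simp

theorem sgn_false (X : Crossing C a b) : C.sgn (X.e false) = X.e false := by
  rw [C.sgn_apply X.gr_false]; simp

end Crossing

section NegCrossing

variable {a b : Fin n}

/-- The element of the complex of a negative crossing with the given polynomials as components. -/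
def pair (a b : Fin n) (p q : Pxy n) : (negCrossing a b).M :=
  ((Ideal.Quotient.mk _ p, Ideal.Quotient.mk _ q) :
    (Pxy n ⧸ blobIdeal a b) × (Pxy n ⧸ idIdeal n))

theorem exists_pair (m : (negCrossing a b).M) : ∃ p q, m = pair a b p q := by
  obtain ⟨u, v⟩ := m
  obtain ⟨p, rfl⟩ := Ideal.Quotient.mk_surjective u
  obtain ⟨q, rfl⟩ := Ideal.Quotient.mk_surjective v
  exact ⟨p, q, rfl⟩

theorem pair_eq {p q p' q' : Pxy n} (hp : p - p' ∈ blobIdeal a b) (hq : q - q' ∈ idIdeal n) :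
    pair a b p q = pair a b p' q' :=
  Prod.ext ((Ideal.Quotient.mk_eq_mk_iff_sub_mem _ _).2 hp)
    ((Ideal.Quotient.mk_eq_mk_iff_sub_mem _ _).2 hq)

theorem pair_add (p q p' q' : Pxy n) :
    pair a b p q + pair a b p' q' = pair a b (p + p') (q + q') :=
  (Prod.ext (map_add _ _ _) (map_add _ _ _)).symm

theorem smul_pair (p u v : Pxy n) : p • pair a b u v = pair a b (p * u) (p * v) := by
  have : (negCrossing a b).act = Algebra.lsmul ℚ ℚ
      ((Pxy n ⧸ blobIdeal a b) × (Pxy n ⧸ idIdeal n)) := by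
    refine MvPolynomial.algHom_ext fun k => ?_
    rcases k with k | k
    · exact (act_xv _ k).trans (congrArg (Algebra.lsmul ℚ ℚ _) (MvPolynomial.rename_X _ _))
    · exact (act_yv _ k).trans (congrArg (Algebra.lsmul ℚ ℚ _) (MvPolynomial.rename_X _ _))
  exact LinearMap.congr_fun (DFunLike.congr_fun this p) (pair a b u v)

theorem pair_mem_fil_one {p q : Pxy n} : pair a b p q ∈ (negCrossing a b).fil 1 ↔
    Ideal.Quotient.mk (blobIdeal a b) p ∈
      Ideal.span {Ideal.Quotient.mk (blobIdeal a b) ((yv b - yv a) - (xv b - xv a))} ∧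
      q ∈ idIdeal n := by
  have h1 : blobFil a b 1 =
    Ideal.span {Ideal.Quotient.mk _ ((yv b - yv a) - (xv b - xv a))} := by simp [blobFil]
  have h2 : idFil n 1 = ⊥ := by simp [idFil]
  rw [← h1, ← Ideal.Quotient.eq_zero_iff_mem (I := idIdeal n), ← Ideal.mem_bot, ← h2]
  exact Iff.rfl

/-- In the blob bimodule, `(y b - y a) - (x b - x a)` equals `2 (y b - x b)` and
`-2 (y a - x a)`. -/
theorem sub_sub_sub_mem_blobIdeal (a b : Fin n) :
    ((yv b - yv a) - (xv b - xv a)) - 2 * (yv b - xv b) ∈ blobIdeal a b ∧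
      ((yv b - yv a) - (xv b - xv a)) - (-2) * (yv a - xv a) ∈ blobIdeal a b := by
  have h : (yv a + yv b) - (xv a + xv b) ∈ blobIdeal a b := Ideal.subset_span (by simp)
  constructor
  · convert neg_mem h using 1; ring
  · convert h using 1; ring

theorem exists_sub_mul_mem_blobIdeal (a b k : Fin n) : ∃ c : Pxy n,
    (yv k - xv k) - c * ((yv b - yv a) - (xv b - xv a)) ∈ blobIdeal a b := by
  have hΔ := sub_sub_sub_mem_blobIdeal a b
  have h2 : (MvPolynomial.C (1 / 2) : Pxy n) * 2 = 1 := by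
    rw [← map_ofNat (MvPolynomial.C : ℚ →+* Pxy n) 2, ← map_mul]; norm_num
  by_cases hb : k = b
  · subst hb
    refine ⟨MvPolynomial.C (1 / 2), ?_⟩
    convert Ideal.mul_mem_left _ (-MvPolynomial.C (1 / 2)) hΔ.1 using 1
    linear_combination (xv k - yv k) * h2
  by_cases ha : k = a
  · subst ha
    refine ⟨-MvPolynomial.C (1 / 2), ?_⟩
    convert Ideal.mul_mem_left _ (MvPolynomial.C (1 / 2)) hΔ.2 using 1
    linear_combination (xv k - yv k) * h2
  · refine ⟨0, ?_⟩
    rw [zero_mul, sub_zero]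
    exact Ideal.subset_span (Or.inr ⟨k, ⟨ha, hb⟩, rfl⟩)

end NegCrossing

/-- The complex of a negative crossing, with its standard generators. -/
def crossingNeg (a b : Fin n) : Crossing (negCrossing a b) a b where
  e
    | true => pair a b 1 0
    | false => pair a b 0 1
  κ
    | true =>
      { toFun := fun m => m.1
        map_add' := fun _ _ => rfl
        map_smul' := fun p m => by
          obtain ⟨u, v, rfl⟩ := exists_pair m
          rw [smul_pair]; rfl }
    | false =>
      { toFun := fun m => m.2
        map_add' := fun _ _ => rfl
        map_smul' := fun p m => by
          obtain ⟨u, v, rfl⟩ := exists_pair m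
          rw [smul_pair]; rfl }
  κ_same ε := by cases ε <;> rfl
  κ_ne ε δ h := by
    cases ε <;> cases δ <;> first | exact absurd rfl h | exact map_zero (Ideal.Quotient.mk _)
  exists_eq m := by
    obtain ⟨p, q, rfl⟩ := exists_pair m
    refine ⟨p, q, ?_⟩
    rw [smul_pair, smul_pair, pair_add]
    simp
  ann ε p hp := by
    have h0 : pair a b 0 0 = 0 := Prod.ext (map_zero _) (map_zero _)
    cases ε <;> rw [smul_pair, ← h0] <;> refine pair_eq ?_ ?_ <;>
      simp_all [crossIdeal]
  gr_true := by
    have h := mem_crossingGr_one a b (q := 0) ⟨1, MvPolynomial.isWeightedHomogeneous_one ℚ _, rfl⟩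
    have h0 : pair a b 1 0 = ((Ideal.Quotient.mk (blobIdeal a b) 1, 0) :
      (Pxy n ⧸ blobIdeal a b) × (Pxy n ⧸ idIdeal n)) := Prod.ext rfl (map_zero _)
    exact h0 ▸ h
  gr_false := by
    have h := mem_crossingGr_zero a b (q := 0) ⟨1, MvPolynomial.isWeightedHomogeneous_one ℚ _, rfl⟩
    have h0 : pair a b 0 1 = ((0, Ideal.Quotient.mk (idIdeal n) 1) :
      (Pxy n ⧸ blobIdeal a b) × (Pxy n ⧸ idIdeal n)) := Prod.ext (map_zero _) rfl
    exact h0 ▸ h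
  d_true := Prod.ext (show 0 = Ideal.Quotient.mk (blobIdeal a b) 0 from (map_zero _).symm) rfl
  d_false := Prod.ext rfl (map_zero (chiMinus a b))
  fil_zero := by
    have h1 : blobFil a b 0 = ⊤ := by simp [blobFil]
    have h2 : idFil n 0 = ⊤ := by simp [idFil]
    rw [eq_top_iff]
    rintro ⟨u, v⟩ -
    exact ⟨h1 ▸ Submodule.mem_top (x := u), h2 ▸ Submodule.mem_top (x := v)⟩
  fil_two := by
    have h1 : blobFil a b 2 = ⊥ := by simp [blobFil]
    have h2 : idFil n 2 = ⊥ := by simp [idFil]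
    rw [eq_bot_iff]
    rintro ⟨u, v⟩ ⟨hu, hv⟩
    have hu' : u ∈ blobFil a b 2 := hu
    have hv' : v ∈ idFil n 2 := hv
    rw [h1, Ideal.mem_bot] at hu'
    rw [h2, Ideal.mem_bot] at hv'
    exact Prod.ext hu' hv'
  sub_smul_mem_fil k m := by
    obtain ⟨u, v, rfl⟩ := exists_pair m
    obtain ⟨c, hc⟩ := exists_sub_mul_mem_blobIdeal a b k
    rw [smul_pair, pair_mem_fil_one]
    refine ⟨Ideal.mem_span_singleton'.2 ⟨Ideal.Quotient.mk _ (c * u), ?_⟩,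
      Ideal.mul_mem_right _ _ (Ideal.subset_span ⟨k, rfl⟩)⟩
    rw [← map_mul, Ideal.Quotient.mk_eq_mk_iff_sub_mem]
    convert Ideal.mul_mem_left _ (-u) hc using 1
    ring
  exists_of_mem_fil k hk m hm := by
    obtain ⟨u, v, rfl⟩ := exists_pair m
    rw [pair_mem_fil_one] at hm
    obtain ⟨c, hc⟩ := Ideal.mem_span_singleton'.1 hm.1
    obtain ⟨c, rfl⟩ := Ideal.Quotient.mk_surjective c
    rw [← map_mul, Ideal.Quotient.mk_eq_mk_iff_sub_mem] at hc
    obtain ⟨s, hs⟩ : ∃ s : Pxy n, ((yv b - yv a) - (xv b - xv a)) - s * (yv k - xv k) ∈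
        blobIdeal a b := by
      rcases hk with rfl | rfl
      · exact ⟨-2, (sub_sub_sub_mem_blobIdeal k b).2⟩
      · exact ⟨2, (sub_sub_sub_mem_blobIdeal a k).1⟩
    refine ⟨pair a b (c * s) 0, ?_⟩
    rw [smul_pair]
    refine pair_eq ?_ (by simpa using hm.2)
    convert sub_mem (Ideal.mul_mem_left _ c hs) hc using 1
    ring

/-! ### The annihilators of the generators -/

section Relations

variable {N : Type} [AddCommGroup N] [Module (Pxy n) N]

/-- `v` is annihilated by the relations of the identity bimodule. -/
def IdRel (v : N) : Prop := ∀ k : Fin n, (yv k : Pxy n) • v = (xv k : Pxy n) • v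

/-- `v` is annihilated by the relations of the blob bimodule on the strands `a`, `b`. -/
structure BlobRel (a b : Fin n) (v : N) : Prop where
  add : (yv a + yv b : Pxy n) • v = (xv a + xv b : Pxy n) • v
  mul : (yv a * yv b : Pxy n) • v = (xv a * xv b : Pxy n) • v
  other : ∀ k, k ≠ a → k ≠ b → (yv k : Pxy n) • v = (xv k : Pxy n) • v

/-- `v` is annihilated by the relations of the tensor product of the blob bimodules on `a`, `b`
and on `b`, `c`. The intermediate variables are `x a`, `y a + y b - x a` and `y c`. -/
structure ChainRel (a b c : Fin n) (v : N) : Prop where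
  sum : (yv a + yv b + yv c : Pxy n) • v = (xv a + xv b + xv c : Pxy n) • v
  left : (yv a * yv b : Pxy n) • v = ((yv a + yv b - xv a) * xv a : Pxy n) • v
  right : ((yv a + yv b - xv a) * yv c : Pxy n) • v = (xv b * xv c : Pxy n) • v
  other : ∀ k, k ≠ a → k ≠ b → k ≠ c → (yv k : Pxy n) • v = (xv k : Pxy n) • v

/-- The elementary symmetric polynomials in the three variables `y` and in the three variables
`x` act in the same way on `v`. -/
structure SymRel (a b c : Fin n) (v : N) : Prop where
  sum : (yv a + yv b + yv c : Pxy n) • v = (xv a + xv b + xv c : Pxy n) • v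
  sum_mul : (yv a * yv b + yv a * yv c + yv b * yv c : Pxy n) • v =
    (xv a * xv b + xv a * xv c + xv b * xv c : Pxy n) • v
  mul : (yv a * yv b * yv c : Pxy n) • v = (xv a * xv b * xv c : Pxy n) • v
  other : ∀ k, k ≠ a → k ≠ b → k ≠ c → (yv k : Pxy n) • v = (xv k : Pxy n) • v

/-- The relations between a generator `v` of the tensor product of the blob bimodules on `a`, `b`,
on `b`, `c` and on `a`, `b`, and its multiple `v'` by the intermediate variable `t` on the strand
`a`. Since `t ^ 2 = (y a + y b) t - y a y b`, the multiple of `v'` by `t` is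
`(y a + y b) v' - y a y b v`. -/
structure BottRel (a b c : Fin n) (v v' : N) : Prop where
  sum : (yv a + yv b + yv c : Pxy n) • v = (xv a + xv b + xv c : Pxy n) • v
  sum' : (yv a + yv b + yv c : Pxy n) • v' = (xv a + xv b + xv c : Pxy n) • v'
  mid : ((yv a + yv b) * yv c - (xv a + xv b) * xv c : Pxy n) • v = (yv c - xv c : Pxy n) • v'
  mid' : ((yv a + yv b) * yv c - (xv a + xv b) * xv c : Pxy n) • v' =
    (yv c - xv c : Pxy n) • ((yv a + yv b : Pxy n) • v' - (yv a * yv b : Pxy n) • v)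
  quad : (yv a + yv b : Pxy n) • v' - (yv a * yv b : Pxy n) • v =
    (xv a + xv b : Pxy n) • v' - (xv a * xv b : Pxy n) • v
  quad' : (yv a + yv b : Pxy n) • ((yv a + yv b : Pxy n) • v' - (yv a * yv b : Pxy n) • v) -
      (yv a * yv b : Pxy n) • v' =
    (xv a + xv b : Pxy n) • ((yv a + yv b : Pxy n) • v' - (yv a * yv b : Pxy n) • v) -
      (xv a * xv b : Pxy n) • v'
  other : ∀ k, k ≠ a → k ≠ b → k ≠ c → (yv k : Pxy n) • v = (xv k : Pxy n) • v
  other' : ∀ k, k ≠ a → k ≠ b → k ≠ c → (yv k : Pxy n) • v' = (xv k : Pxy n) • v'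

/-- The relations that the images of the generators `genFamily` of the triple tensor product have
to satisfy. -/
structure GenRel (a b c : Fin n) (v : (Bool × Bool × Bool) ⊕ Bool → N) : Prop where
  ttt : BottRel a b c (v (Sum.inl (true, true, true))) (v (Sum.inr true))
  ftt : ChainRel c b a (v (Sum.inl (false, true, true)))
  tft : BlobRel a b (v (Sum.inl (true, false, true)))
  tft' : BlobRel a b (v (Sum.inr false))
  ttf : ChainRel a b c (v (Sum.inl (true, true, false)))
  fft : BlobRel a b (v (Sum.inl (false, false, true)))
  ftf : BlobRel b c (v (Sum.inl (false, true, false)))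
  tff : BlobRel a b (v (Sum.inl (true, false, false)))
  fff : IdRel (n := n) (v (Sum.inl (false, false, false)))

variable {a b c : Fin n} {v v' w : N}

theorem IdRel.blobRel (h : IdRel (n := n) v) (a b : Fin n) : BlobRel a b v where
  add := by linear_combination (norm := module) h a + h b
  mul := by linear_combination (norm := module) (yv b : Pxy n) • h a + (xv a : Pxy n) • h b
  other k _ _ := h k

theorem blobRel_zero (a b : Fin n) : BlobRel a b (0 : N) :=
  ⟨by simp, by simp, fun _ _ _ => by simp⟩

theorem idRel_zero : IdRel (n := n) (0 : N) := fun _ => by simp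

theorem BlobRel.symm (h : BlobRel a b v) : BlobRel b a v where
  add := by linear_combination (norm := module) h.add
  mul := by linear_combination (norm := module) h.mul
  other k h1 h2 := h.other k h2 h1

theorem BlobRel.smul (h : BlobRel a b v) (p : Pxy n) : BlobRel a b (p • v) where
  add := by linear_combination (norm := module) p • h.add
  mul := by linear_combination (norm := module) p • h.mul
  other k h1 h2 := by linear_combination (norm := module) p • h.other k h1 h2

theorem BlobRel.add' (h : BlobRel a b v) (h' : BlobRel a b w) : BlobRel a b (v + w) where
  add := by linear_combination (norm := module) h.add + h'.add
  mul := by linear_combination (norm := module) h.mul + h'.mul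
  other k h1 h2 := by linear_combination (norm := module) h.other k h1 h2 + h'.other k h1 h2

theorem ChainRel.sub (h : ChainRel a b c v) (h' : ChainRel a b c w) :
    ChainRel a b c (v - w) where
  sum := by linear_combination (norm := module) h.sum - h'.sum
  left := by linear_combination (norm := module) h.left - h'.left
  right := by linear_combination (norm := module) h.right - h'.right
  other k h1 h2 h3 := by
    linear_combination (norm := module) h.other k h1 h2 h3 - h'.other k h1 h2 h3

/-- The blob bimodule on `a`, `b` is a quotient of both tensor products with the one on `b`,
`c`. -/
theorem BlobRel.chainRel (h : BlobRel a b v) (hc : c ≠ a ∧ c ≠ b) : ChainRel a b c v where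
  sum := by linear_combination (norm := module) h.add + h.other c hc.1 hc.2
  left := by linear_combination (norm := module) h.mul - (xv a : Pxy n) • h.add
  right := by
    linear_combination (norm := module) (yv c : Pxy n) • h.add +
      (xv b : Pxy n) • h.other c hc.1 hc.2
  other k h1 h2 _ := h.other k h1 h2

theorem BlobRel.chainRel' (h : BlobRel a b v) (hc : c ≠ a ∧ c ≠ b) : ChainRel c b a v where
  sum := by linear_combination (norm := module) h.add + h.other c hc.1 hc.2
  left := by
    linear_combination (norm := module) (yv b - xv c : Pxy n) • h.other c hc.1 hc.2
  right := by
    linear_combination (norm := module) h.mul + (yv a : Pxy n) • h.other c hc.1 hc.2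
  other k _ h2 h3 := h.other k h3 h2

/-- The map of bimodules from `B_a B_b` to `B_a` given by multiplication with `y c - x b`. -/
theorem ChainRel.blobRel (h : ChainRel a b c v) : BlobRel a b ((yv c - xv b : Pxy n) • v) where
  add := by linear_combination (norm := module) h.right - (xv b : Pxy n) • h.sum
  mul := by
    linear_combination (norm := module) (yv c - xv b : Pxy n) • h.left +
      (xv a : Pxy n) • h.right - (xv a * xv b : Pxy n) • h.sum
  other k h1 h2 := by
    by_cases h3 : k = c
    · subst h3
      linear_combination (norm := module) (yv k : Pxy n) • h.sum - h.right
    · linear_combination (norm := module) (yv c - xv b : Pxy n) • h.other k h1 h2 h3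

/-- The mirror image of `ChainRel.blobRel`, for the tensor product of the bimodules in the opposite
order. -/
theorem ChainRel.blobRel' (h : ChainRel c b a v) : BlobRel a b ((xv c - yv b : Pxy n) • v) where
  add := by
    linear_combination (norm := module) (xv c - yv b : Pxy n) • h.sum + h.left
  mul := by
    linear_combination (norm := module) (yv a : Pxy n) • h.left + (xv c - yv b : Pxy n) • h.right
  other k h1 h2 := by
    by_cases h3 : k = c
    · subst h3
      linear_combination (norm := module) - h.left
    · linear_combination (norm := module) (xv c - yv b : Pxy n) • h.other k h3 h2 h1

theorem BlobRel.bottRel (h : BlobRel a b v) (h' : BlobRel a b v') (hc : c ≠ a ∧ c ≠ b) :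
    BottRel a b c v v' where
  sum := by linear_combination (norm := module) h.add + h.other c hc.1 hc.2
  sum' := by linear_combination (norm := module) h'.add + h'.other c hc.1 hc.2
  mid := by
    linear_combination (norm := module) (yv c : Pxy n) • h.add +
      (xv a + xv b : Pxy n) • h.other c hc.1 hc.2 - h'.other c hc.1 hc.2
  mid' := by
    linear_combination (norm := module) (xv c : Pxy n) • h'.add +
      (yv a * yv b : Pxy n) • h.other c hc.1 hc.2
  quad := by linear_combination (norm := module) h'.add - h.mul
  quad' := by
    linear_combination (norm := module) (yv a + yv b : Pxy n) • h'.add - h'.mul -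
      (yv a * yv b : Pxy n) • h.add
  other k h1 h2 _ := h.other k h1 h2
  other' k h1 h2 _ := h'.other k h1 h2

theorem ChainRel.bottRel (h : ChainRel a b c v) : BottRel a b c v ((xv a : Pxy n) • v) where
  sum := h.sum
  sum' := by linear_combination (norm := module) (xv a : Pxy n) • h.sum
  mid := by linear_combination (norm := module) h.right
  mid' := by
    linear_combination (norm := module) (xv a : Pxy n) • h.right +
      (yv c - xv c : Pxy n) • h.left
  quad := by linear_combination (norm := module) - h.left
  quad' := by
    linear_combination (norm := module) (xv a + xv b - yv a - yv b : Pxy n) • h.left -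
      (xv a : Pxy n) • h.left
  other := h.other
  other' k h1 h2 h3 := by linear_combination (norm := module) (xv a : Pxy n) • h.other k h1 h2 h3

theorem ChainRel.bottRel' (h : ChainRel c b a v) : BottRel a b c v ((yv a : Pxy n) • v) where
  sum := by linear_combination (norm := module) h.sum
  sum' := by linear_combination (norm := module) (yv a : Pxy n) • h.sum
  mid := by linear_combination (norm := module) h.left + (xv c : Pxy n) • h.sum
  mid' := by
    linear_combination (norm := module) (yv a : Pxy n) • h.left + (yv a * xv c : Pxy n) • h.sum
  quad := by linear_combination (norm := module) (yv a : Pxy n) • h.sum - h.right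
  quad' := by
    linear_combination (norm := module) (yv a * yv a : Pxy n) • h.sum - (yv a : Pxy n) • h.right
  other k h1 h2 h3 := h.other k h3 h2 h1
  other' k h1 h2 h3 := by linear_combination (norm := module) (yv a : Pxy n) • h.other k h3 h2 h1

theorem SymRel.reverse (h : SymRel a b c v) : SymRel c b a v where
  sum := by linear_combination (norm := module) h.sum
  sum_mul := by linear_combination (norm := module) h.sum_mul
  mul := by linear_combination (norm := module) h.mul
  other k h1 h2 h3 := h.other k h3 h2 h1

/-- The value `x a + x b - y c` of the intermediate variable is compatible with all the relations
of the triple tensor product. -/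
theorem SymRel.bottRel (h : SymRel a b c v) :
    BottRel a b c v ((xv a + xv b - yv c : Pxy n) • v) where
  sum := h.sum
  sum' := by linear_combination (norm := module) (xv a + xv b - yv c : Pxy n) • h.sum
  mid := by linear_combination (norm := module) (yv c : Pxy n) • h.sum
  mid' := by
    linear_combination (norm := module) h.mul - (xv c : Pxy n) • h.sum_mul +
      (xv c * (xv a + xv b) : Pxy n) • h.sum
  quad := by
    linear_combination (norm := module) (xv a + xv b : Pxy n) • h.sum - h.sum_mul
  quad' := by
    linear_combination (norm := module) ((yv a + yv b) * (xv a + xv b) : Pxy n) • h.sum -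
      (yv a + yv b : Pxy n) • h.sum_mul + h.mul - (xv a * xv b : Pxy n) • h.sum
  other := h.other
  other' k h1 h2 h3 := by
    linear_combination (norm := module) (xv a + xv b - yv c : Pxy n) • h.other k h1 h2 h3

theorem BottRel.symRel (h : BottRel a b c v v') : SymRel a b c v where
  sum := h.sum
  sum_mul := by
    linear_combination (norm := module) h.mid - h.quad + h.sum'
  mul := by
    linear_combination (norm := module) h.mid' - (xv c : Pxy n) • h.quad
  other := h.other

/-- With `v'` the multiple of `v` by the intermediate variable `t`, the multiple of `v` by
`t - (x a + x b - y c)` satisfies the relations of the blob bimodule. This is the part that is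
complementary to that of `SymRel.bottRel`. -/
theorem BottRel.blobRel (h : BottRel a b c v v') :
    BlobRel a b (v' - (xv a + xv b - yv c : Pxy n) • v) where
  add := by
    linear_combination (norm := module) h.mid + h.sum' - (xv a + xv b : Pxy n) • h.sum
  mul := by
    linear_combination (norm := module) (yv a + yv b - xv c : Pxy n) • h.quad - h.quad' +
      h.mid' - (xv a * xv b : Pxy n) • h.sum
  other k h1 h2 := by
    by_cases h3 : k = c
    · subst h3
      linear_combination (norm := module) (yv k : Pxy n) • h.sum - h.mid
    · linear_combination (norm := module) h.other' k h1 h2 h3 -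
        (xv a + xv b - yv c : Pxy n) • h.other k h1 h2 h3

end Relations

/-! ### Triple tensor products and their generators -/

/-- The tensor product of three complexes, the outer two being equal. -/
abbrev triple (C D : FilteredComplex n) : FilteredComplex n := C.tensor (D.tensor C)

section Triple

variable {C D : FilteredComplex n}

/-- The class of `m₁ ⊗ m₂ ⊗ m₃`. -/
def tri (m₁ : C.M) (m₂ : D.M) (m₃ : C.M) : (triple C D).M :=
  tmk C (D.tensor C) m₁ (tmk D C m₂ m₃)

/-- The action of the intermediate variable on the strand `k` between the first two factors. -/
def zop (C D : FilteredComplex n) (k : Fin n) : (triple C D).M →ₗ[Pxy n] (triple C D).M :=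
  idTensor C (LinearMap.lsmul (Pxy n) (D.tensor C).M (yv k))

/-- The action of the intermediate variable on the strand `k` between the last two factors. -/
def wop (C D : FilteredComplex n) (k : Fin n) : (triple C D).M →ₗ[Pxy n] (triple C D).M :=
  idTensor C (idTensor D (LinearMap.lsmul (Pxy n) C.M (yv k)))

theorem yv_smul_tri (k : Fin n) (m₁ : C.M) (m₂ : D.M) (m₃ : C.M) :
    (yv k : Pxy n) • tri m₁ m₂ m₃ = tri ((yv k : Pxy n) • m₁) m₂ m₃ :=
  yv_smul_tmk _ _ _

theorem xv_smul_tri (k : Fin n) (m₁ : C.M) (m₂ : D.M) (m₃ : C.M) :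
    (xv k : Pxy n) • tri m₁ m₂ m₃ = tri m₁ m₂ ((xv k : Pxy n) • m₃) := by
  rw [tri, xv_smul_tmk, xv_smul_tmk, tri]

theorem zop_tri (k : Fin n) (m₁ : C.M) (m₂ : D.M) (m₃ : C.M) :
    zop C D k (tri m₁ m₂ m₃) = tri ((xv k : Pxy n) • m₁) m₂ m₃ := by
  rw [tri, zop, idTensor_tmk, LinearMap.lsmul_apply, ← xv_smul_tmk_left, tri]

theorem zop_tri' (k : Fin n) (m₁ : C.M) (m₂ : D.M) (m₃ : C.M) :
    zop C D k (tri m₁ m₂ m₃) = tri m₁ ((yv k : Pxy n) • m₂) m₃ := by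
  rw [tri, zop, idTensor_tmk, LinearMap.lsmul_apply, yv_smul_tmk, tri]

theorem wop_tri (k : Fin n) (m₁ : C.M) (m₂ : D.M) (m₃ : C.M) :
    wop C D k (tri m₁ m₂ m₃) = tri m₁ ((xv k : Pxy n) • m₂) m₃ := by
  rw [tri, wop, idTensor_tmk, idTensor_tmk, LinearMap.lsmul_apply, ← xv_smul_tmk_left, tri]

theorem wop_tri' (k : Fin n) (m₁ : C.M) (m₂ : D.M) (m₃ : C.M) :
    wop C D k (tri m₁ m₂ m₃) = tri m₁ m₂ ((yv k : Pxy n) • m₃) := by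
  rw [tri, wop, idTensor_tmk, idTensor_tmk, LinearMap.lsmul_apply, tri]

theorem d_zop (k : Fin n) (m : (triple C D).M) :
    (triple C D).d (zop C D k m) = zop C D k ((triple C D).d m) :=
  d_idTensor _ (fun m => by
    rw [LinearMap.lsmul_apply, LinearMap.lsmul_apply, ← dP_apply, map_smul, dP_apply]) m

theorem tri_add_left (m₁ m₁' : C.M) (m₂ : D.M) (m₃ : C.M) :
    tri (m₁ + m₁') m₂ m₃ = tri m₁ m₂ m₃ + tri m₁' m₂ m₃ :=
  tmk_add_left _ _ _

theorem tri_add_mid (m₁ : C.M) (m₂ m₂' : D.M) (m₃ : C.M) :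
    tri m₁ (m₂ + m₂') m₃ = tri m₁ m₂ m₃ + tri m₁ m₂' m₃ := by
  rw [tri, tmk_add_left, tmk_add_right, tri, tri]

theorem tri_add_right (m₁ : C.M) (m₂ : D.M) (m₃ m₃' : C.M) :
    tri m₁ m₂ (m₃ + m₃') = tri m₁ m₂ m₃ + tri m₁ m₂ m₃' := by
  rw [tri, tmk_add_right, tmk_add_right, tri, tri]

theorem d_tri (m₁ : C.M) (m₂ : D.M) (m₃ : C.M) : (triple C D).d (tri m₁ m₂ m₃) =
    tri (C.d m₁) m₂ m₃ + tri (C.sgn m₁) (D.d m₂) m₃ + tri (C.sgn m₁) (D.sgn m₂) (C.d m₃) := by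
  rw [tri, d_tmk, d_tmk, tmk_add_right, ← add_assoc, tri, tri, tri]

/-- Maps of `ℚ[x, y]`-modules out of a triple tensor product agree if they agree on pure
tensors. -/
theorem triple_ext {N : Type} [AddCommGroup N] [Module (Pxy n) N]
    {f g : (triple C D).M →ₗ[Pxy n] N} (h : ∀ m₁ m₂ m₃, f (tri m₁ m₂ m₃) = g (tri m₁ m₂ m₃))
    (x : (triple C D).M) : f x = g x := by
  induction x using tensor_induction with
  | zero => rw [map_zero, map_zero]
  | add x y hx hy => rw [map_add, map_add, hx, hy]
  | tmk m₁ x =>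
    induction x using tensor_induction with
    | zero => rw [tmk_zero_right, map_zero, map_zero]
    | add x y hx hy => rw [tmk_add_right, map_add, map_add, hx, hy]
    | tmk m₂ m₃ => exact h m₁ m₂ m₃

variable {a b c : Fin n}

theorem zop_add (X : Crossing C a b) (m : (triple C D).M) :
    zop C D a m + zop C D b m = (yv a + yv b : Pxy n) • m :=
  triple_ext (f := zop C D a + zop C D b) (g := LinearMap.lsmul (Pxy n) _ (yv a + yv b))
    (fun m₁ m₂ m₃ => by
      rw [LinearMap.add_apply, LinearMap.lsmul_apply, zop_tri, zop_tri, ← tri_add_left,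
        ← add_smul, ← X.add_smul_eq, add_smul, add_smul, yv_smul_tri, yv_smul_tri,
        tri_add_left]) m

theorem zop_zop (X : Crossing C a b) (m : (triple C D).M) :
    zop C D a (zop C D b m) = (yv a * yv b : Pxy n) • m :=
  triple_ext (f := zop C D a ∘ₗ zop C D b) (g := LinearMap.lsmul (Pxy n) _ (yv a * yv b))
    (fun m₁ m₂ m₃ => by
      rw [LinearMap.comp_apply, LinearMap.lsmul_apply, zop_tri, zop_tri, ← mul_smul,
        ← X.mul_smul_eq, mul_smul, mul_smul, yv_smul_tri, yv_smul_tri]) m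

theorem zop_other (X : Crossing C a b) {k : Fin n} (ha : k ≠ a) (hb : k ≠ b)
    (m : (triple C D).M) : zop C D k m = (yv k : Pxy n) • m :=
  triple_ext (f := zop C D k) (g := LinearMap.lsmul (Pxy n) _ (yv k))
    (fun m₁ m₂ m₃ => by
      rw [LinearMap.lsmul_apply, zop_tri, yv_smul_tri, X.smul_eq ha hb]) m

theorem wop_add (X : Crossing C a b) (m : (triple C D).M) :
    wop C D a m + wop C D b m = (xv a + xv b : Pxy n) • m :=
  triple_ext (f := wop C D a + wop C D b) (g := LinearMap.lsmul (Pxy n) _ (xv a + xv b))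
    (fun m₁ m₂ m₃ => by
      rw [LinearMap.add_apply, LinearMap.lsmul_apply, wop_tri', wop_tri', ← tri_add_right,
        ← add_smul, X.add_smul_eq, add_smul, add_smul, xv_smul_tri, xv_smul_tri,
        tri_add_right]) m

theorem wop_wop (X : Crossing C a b) (m : (triple C D).M) :
    wop C D a (wop C D b m) = (xv a * xv b : Pxy n) • m :=
  triple_ext (f := wop C D a ∘ₗ wop C D b) (g := LinearMap.lsmul (Pxy n) _ (xv a * xv b))
    (fun m₁ m₂ m₃ => by
      rw [LinearMap.comp_apply, LinearMap.lsmul_apply, wop_tri', wop_tri', ← mul_smul,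
        X.mul_smul_eq, mul_smul, mul_smul, xv_smul_tri, xv_smul_tri]) m

theorem wop_other (X : Crossing C a b) {k : Fin n} (ha : k ≠ a) (hb : k ≠ b)
    (m : (triple C D).M) : wop C D k m = (xv k : Pxy n) • m :=
  triple_ext (f := wop C D k) (g := LinearMap.lsmul (Pxy n) _ (xv k))
    (fun m₁ m₂ m₃ => by
      rw [LinearMap.lsmul_apply, wop_tri', xv_smul_tri, X.smul_eq ha hb]) m

theorem zop_add_eq_wop_add (Y : Crossing D b c) (m : (triple C D).M) :
    zop C D b m + zop C D c m = wop C D b m + wop C D c m :=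
  triple_ext (f := zop C D b + zop C D c) (g := wop C D b + wop C D c)
    (fun m₁ m₂ m₃ => by
      rw [LinearMap.add_apply, LinearMap.add_apply, zop_tri', zop_tri', wop_tri, wop_tri,
        ← tri_add_mid, ← tri_add_mid, ← add_smul, ← add_smul, Y.add_smul_eq]) m

theorem zop_zop_eq_wop_wop (Y : Crossing D b c) (m : (triple C D).M) :
    zop C D b (zop C D c m) = wop C D b (wop C D c m) :=
  triple_ext (f := zop C D b ∘ₗ zop C D c) (g := wop C D b ∘ₗ wop C D c)
    (fun m₁ m₂ m₃ => by
      rw [LinearMap.comp_apply, LinearMap.comp_apply, zop_tri', zop_tri', wop_tri, wop_tri,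
        ← mul_smul, ← mul_smul, Y.mul_smul_eq]) m

theorem zop_eq_wop (Y : Crossing D b c) {k : Fin n} (hb : k ≠ b) (hc : k ≠ c)
    (m : (triple C D).M) : zop C D k m = wop C D k m :=
  triple_ext (f := zop C D k) (g := wop C D k)
    (fun m₁ m₂ m₃ => by rw [zop_tri', wop_tri, Y.smul_eq hb hc]) m

/-- The actions of the intermediate variables on the strands `a` and `b` are all determined by that
of the variable `t` on the strand `a`. The middle factor does not involve this strand, so that `t`
is the same variable on its two sides. -/
theorem zop_wop_eq (X : Crossing C a b) (Y : Crossing D b c) (hab : a ≠ b) (hac : a ≠ c)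
    (m : (triple C D).M) :
    zop C D b m = (yv a + yv b : Pxy n) • m - zop C D a m ∧ wop C D a m = zop C D a m ∧
      wop C D b m = (xv a + xv b : Pxy n) • m - zop C D a m := by
  have h := zop_eq_wop Y hab hac m
  refine ⟨?_, h.symm, ?_⟩
  · rw [← zop_add X]; abel
  · rw [← wop_add X, h]; abel

theorem zop_zop_self (X : Crossing C a b) (m : (triple C D).M) :
    zop C D a (zop C D a m) =
      (yv a + yv b : Pxy n) • zop C D a m - (yv a * yv b : Pxy n) • m := by
  have h := zop_zop X m
  rw [← map_smul, ← zop_add X, map_add, h]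
  abel

/-- All relations between an element and its multiple by `t` come from the symmetric functions of
the intermediate variables. The primed ones are the others for the multiple by `t`. -/
theorem bottRel_zop (X : Crossing C a b) (Y : Crossing D b c) (hab : a ≠ b) (hac : a ≠ c)
    (hbc : b ≠ c) (m : (triple C D).M) : BottRel a b c m (zop C D a m) := by
  have hz := zop_wop_eq X Y hab hac
  have sum : ∀ m : (triple C D).M,
      (yv a + yv b + yv c : Pxy n) • m = (xv a + xv b + xv c : Pxy n) • m := by
    intro m
    have h := zop_add_eq_wop_add Y m
    rw [zop_other X hac.symm hbc.symm, wop_other X hac.symm hbc.symm, (hz m).1, (hz m).2.2] at h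
    linear_combination (norm := module) h
  have mid : ∀ m : (triple C D).M,
      ((yv a + yv b) * yv c - (xv a + xv b) * xv c : Pxy n) • m =
        (yv c - xv c : Pxy n) • zop C D a m := by
    intro m
    have h := zop_zop_eq_wop_wop Y m
    rw [zop_other X hac.symm hbc.symm, wop_other X hac.symm hbc.symm, map_smul, map_smul,
      (hz m).1, (hz m).2.2] at h
    linear_combination (norm := module) h
  have quad : ∀ m : (triple C D).M,
      (yv a + yv b : Pxy n) • zop C D a m - (yv a * yv b : Pxy n) • m =
        (xv a + xv b : Pxy n) • zop C D a m - (xv a * xv b : Pxy n) • m := by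
    intro m
    rw [← zop_zop_self X]
    have h := wop_wop X m
    rw [(hz m).2.2, (hz _).2.1, map_sub, map_smul] at h
    linear_combination (norm := module) -h
  have other : ∀ m : (triple C D).M, ∀ k, k ≠ a → k ≠ b → k ≠ c →
      (yv k : Pxy n) • m = (xv k : Pxy n) • m := by
    intro m k h1 h2 h3
    rw [← zop_other X h1 h2, ← wop_other X h1 h2, zop_eq_wop Y h2 h3]
  refine ⟨sum _, sum _, mid _, ?_, quad _, ?_, other _, other _⟩
  · rw [← zop_zop_self X]; exact mid _
  · rw [← zop_zop_self X]; exact quad _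

/-! ### Generators of the triple tensor product -/

/-- The generator of the summand of the triple tensor product in which the factors with value
`true` are blob bimodules and those with value `false` are identity bimodules. -/
def gen (X : Crossing C a b) (Y : Crossing D b c) (ε : Bool × Bool × Bool) : (triple C D).M :=
  tri (X.e ε.1) (Y.e ε.2.1) (X.e ε.2.2)

theorem zop_gen_of_left (X : Crossing C a b) (Y : Crossing D b c) (k : Fin n) (ε : Bool × Bool) :
    zop C D k (gen X Y (false, ε)) = (yv k : Pxy n) • gen X Y (false, ε) := by
  rw [gen, zop_tri, ← X.smul_false, yv_smul_tri]

theorem wop_gen_of_right (X : Crossing C a b) (Y : Crossing D b c) (k : Fin n) (ε δ : Bool) :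
    wop C D k (gen X Y (ε, δ, false)) = (xv k : Pxy n) • gen X Y (ε, δ, false) := by
  rw [gen, wop_tri', X.smul_false, xv_smul_tri]

theorem zop_eq_wop_of_mid (Y : Crossing D b c) (k : Fin n) (m₁ m₃ : C.M) :
    zop C D k (tri m₁ (Y.e false) m₃) = wop C D k (tri m₁ (Y.e false) m₃) := by
  rw [zop_tri', Y.smul_false, wop_tri]

theorem zop_gen_of_right (X : Crossing C a b) (Y : Crossing D b c) (hab : a ≠ b) (hac : a ≠ c)
    (ε δ : Bool) :
    zop C D a (gen X Y (ε, δ, false)) = (xv a : Pxy n) • gen X Y (ε, δ, false) := by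
  rw [← wop_gen_of_right, zop_eq_wop Y hab hac]

theorem blobRel_of_mid (X : Crossing C a b) (Y : Crossing D b c) (m₁ m₃ : C.M) :
    BlobRel a b (tri m₁ (Y.e false) m₃) where
  add := by
    rw [← zop_add X, ← wop_add X, zop_eq_wop_of_mid, zop_eq_wop_of_mid]
  mul := by
    rw [← zop_zop X, ← wop_wop X, zop_eq_wop_of_mid, wop_tri', zop_eq_wop_of_mid]
  other k h1 h2 := by
    rw [← zop_other X h1 h2, ← wop_other X h1 h2, zop_eq_wop_of_mid]

theorem chainRel_gen_of_right (X : Crossing C a b) (Y : Crossing D b c) (hab : a ≠ b)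
    (hac : a ≠ c) (hbc : b ≠ c) (ε δ : Bool) : ChainRel a b c (gen X Y (ε, δ, false)) := by
  have h := bottRel_zop X Y hab hac hbc (gen X Y (ε, δ, false))
  rw [zop_gen_of_right X Y hab hac] at h
  refine ⟨h.sum, ?_, ?_, h.other⟩
  · linear_combination (norm := module) -h.quad
  · linear_combination (norm := module) h.mid

theorem chainRel_gen_of_left (X : Crossing C a b) (Y : Crossing D b c) (hab : a ≠ b)
    (hac : a ≠ c) (hbc : b ≠ c) (ε : Bool × Bool) : ChainRel c b a (gen X Y (false, ε)) := by
  have h := bottRel_zop X Y hab hac hbc (gen X Y (false, ε))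
  rw [zop_gen_of_left] at h
  refine ⟨?_, ?_, ?_, fun k h1 h2 h3 => h.other k h3 h2 h1⟩
  · linear_combination (norm := module) h.sum
  · linear_combination (norm := module) h.mid - (xv c : Pxy n) • h.sum
  · linear_combination (norm := module) (yv a : Pxy n) • h.sum - h.quad

theorem blobRel_gen_outer (X : Crossing C a b) (Y : Crossing D b c) (ε : Bool) :
    BlobRel b c (gen X Y (false, ε, false)) where
  add := by
    rw [add_smul, add_smul, ← zop_gen_of_left, ← zop_gen_of_left, ← wop_gen_of_right,
      ← wop_gen_of_right, zop_add_eq_wop_add Y]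
  mul := by
    rw [mul_comm (yv b), mul_comm (xv b), mul_smul, mul_smul, ← zop_gen_of_left,
      ← wop_gen_of_right, ← map_smul, ← map_smul, ← zop_gen_of_left, ← wop_gen_of_right,
      zop_zop_eq_wop_wop Y]
  other k h1 h2 := by
    rw [← zop_gen_of_left, ← wop_gen_of_right, zop_eq_wop Y h1 h2]

theorem idRel_gen (X : Crossing C a b) (Y : Crossing D b c) :
    IdRel (n := n) (gen X Y (false, false, false)) := fun k => by
  rw [← zop_gen_of_left, ← wop_gen_of_right]
  exact zop_eq_wop_of_mid _ _ _ _

/-- To see that a linear map sends all multiples of `v` to `N`, it suffices to multiply by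
variables. -/
theorem map_smul_mem {V : Type} [AddCommGroup V] [Module ℚ V] [Module (Pxy n) V]
    [IsScalarTower ℚ (Pxy n) V] {W : Type} [AddCommGroup W] [Module ℚ W] {N : Submodule ℚ W}
    (F : V → W) (hadd : ∀ u v, F (u + v) = F u + F v) (hsmul : ∀ (s : ℚ) v, F (s • v) = s • F v)
    (hx : ∀ v, F v ∈ N → ∀ k, F ((xv k : Pxy n) • v) ∈ N)
    (hy : ∀ v, F v ∈ N → ∀ k, F ((yv k : Pxy n) • v) ∈ N) {v : V} (hv : F v ∈ N) (p : Pxy n) :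
    F (p • v) ∈ N := by
  induction p using MvPolynomial.induction_on generalizing v with
  | C a =>
    have : (MvPolynomial.C a : Pxy n) = a • 1 := by
      rw [MvPolynomial.smul_eq_C_mul, mul_one]
    rw [this, smul_assoc, one_smul, hsmul]
    exact N.smul_mem _ hv
  | add p q hp hq => rw [add_smul, hadd]; exact N.add_mem (hp hv) (hq hv)
  | mul_X p k hp =>
    rw [mul_smul]
    rcases k with k | k
    · exact hp (hx v hv k)
    · exact hp (hy v hv k)

/-- A submodule that is closed under the intermediate variables is closed under the actions of
polynomials on each of the three factors. -/
theorem tri_smul_mem {N : Submodule (Pxy n) (triple C D).M} (hz : ∀ k, ∀ m ∈ N, zop C D k m ∈ N)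
    (hw : ∀ k, ∀ m ∈ N, wop C D k m ∈ N) {m₁ : C.M} {m₂ : D.M} {m₃ : C.M}
    (h : tri m₁ m₂ m₃ ∈ N) (p q r : Pxy n) : tri (p • m₁) (q • m₂) (r • m₃) ∈ N := by
  have h1 : tri (p • m₁) m₂ m₃ ∈ N :=
    map_smul_mem (N := N.restrictScalars ℚ) (fun m => tri m m₂ m₃)
      (fun _ _ => tri_add_left _ _ _ _) (fun _ _ => tmk_smul_left _ _ _)
      (fun v hv k => by rw [← zop_tri]; exact hz k _ hv)
      (fun v hv k => by rw [← yv_smul_tri]; exact N.smul_mem _ hv) h p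
  have h2 : tri (p • m₁) (q • m₂) m₃ ∈ N :=
    map_smul_mem (N := N.restrictScalars ℚ) (fun m => tri (p • m₁) m m₃)
      (fun _ _ => tri_add_mid _ _ _ _)
      (fun _ _ => by rw [tri, tmk_smul_left, tmk_smul_right, tri])
      (fun v hv k => by rw [← wop_tri]; exact hw k _ hv)
      (fun v hv k => by rw [← zop_tri']; exact hz k _ hv) h1 q
  exact map_smul_mem (N := N.restrictScalars ℚ) (fun m => tri (p • m₁) (q • m₂) m)
    (fun _ _ => tri_add_right _ _ _ _)
    (fun _ _ => by rw [tri, tmk_smul_right, tmk_smul_right, tri])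
    (fun v hv k => by rw [← xv_smul_tri]; exact N.smul_mem _ hv)
    (fun v hv k => by rw [← wop_tri']; exact hw k _ hv) h2 r

/-- The homogeneous generators of the triple tensor product over `ℚ[x, y]`: the generators of the
eight summands, together with their multiples by the intermediate variable in the two summands
that are not cyclic. -/
def genFamily (X : Crossing C a b) (Y : Crossing D b c) :
    (Bool × Bool × Bool) ⊕ Bool → (triple C D).M
  | Sum.inl ε => gen X Y ε
  | Sum.inr δ => zop C D a (gen X Y (true, δ, true))

theorem span_genFamily (X : Crossing C a b) (Y : Crossing D b c) (hab : a ≠ b) (hac : a ≠ c) :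
    Submodule.span (Pxy n) (Set.range (genFamily X Y)) = ⊤ := by
  set N := Submodule.span (Pxy n) (Set.range (genFamily X Y)) with hN
  have hgen : ∀ ε, gen X Y ε ∈ N := fun ε => Submodule.subset_span ⟨Sum.inl ε, rfl⟩
  have ht : ∀ m ∈ N, zop C D a m ∈ N := by
    intro m hm
    have : N ≤ N.comap (zop C D a) := by
      rw [hN, Submodule.span_le]
      rintro _ ⟨⟨ε₁, ε₂, ε₃⟩ | δ, rfl⟩
      · rw [← hN]
        change zop C D a (gen X Y (ε₁, ε₂, ε₃)) ∈ N
        cases ε₁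
        · rw [zop_gen_of_left]; exact N.smul_mem _ (hgen _)
        · cases ε₃
          · rw [zop_gen_of_right X Y hab hac]; exact N.smul_mem _ (hgen _)
          · exact Submodule.subset_span ⟨Sum.inr ε₂, rfl⟩
      · rw [← hN]
        change zop C D a (zop C D a (gen X Y (true, δ, true))) ∈ N
        rw [zop_zop_self X]
        exact N.sub_mem (N.smul_mem _ (Submodule.subset_span ⟨Sum.inr δ, rfl⟩))
          (N.smul_mem _ (hgen _))
    exact this hm
  have hz : ∀ k, ∀ m ∈ N, zop C D k m ∈ N := by
    intro k m hm
    by_cases h1 : k = a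
    · exact h1 ▸ ht m hm
    by_cases h2 : k = b
    · rw [h2, (zop_wop_eq X Y hab hac m).1]
      exact N.sub_mem (N.smul_mem _ hm) (ht m hm)
    · rw [zop_other X h1 h2]
      exact N.smul_mem _ hm
  have hw : ∀ k, ∀ m ∈ N, wop C D k m ∈ N := by
    intro k m hm
    by_cases h1 : k = a
    · rw [h1, (zop_wop_eq X Y hab hac m).2.1]
      exact ht m hm
    by_cases h2 : k = b
    · rw [h2, (zop_wop_eq X Y hab hac m).2.2]
      exact N.sub_mem (N.smul_mem _ hm) (ht m hm)
    · rw [wop_other X h1 h2]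
      exact N.smul_mem _ hm
  have htri : ∀ m₁ m₂ m₃, tri m₁ m₂ m₃ ∈ N := by
    intro m₁ m₂ m₃
    obtain ⟨p₁, q₁, rfl⟩ := X.exists_eq m₁
    obtain ⟨p₂, q₂, rfl⟩ := Y.exists_eq m₂
    obtain ⟨p₃, q₃, rfl⟩ := X.exists_eq m₃
    have h : ∀ ε₁ ε₂ ε₃ (p q r : Pxy n), tri (p • X.e ε₁) (q • Y.e ε₂) (r • X.e ε₃) ∈ N :=
      fun ε₁ ε₂ ε₃ => tri_smul_mem hz hw (hgen (ε₁, ε₂, ε₃))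
    simp only [tri_add_left, tri_add_mid, tri_add_right]
    repeat' apply N.add_mem
    all_goals apply h
  have : N.mkQ = 0 := LinearMap.ext fun x => triple_ext (g := 0) (fun m₁ m₂ m₃ => by
    rw [Submodule.mkQ_apply, LinearMap.zero_apply, Submodule.Quotient.mk_eq_zero]
    exact htri _ _ _) x
  rw [← Submodule.ker_mkQ N, this, LinearMap.ker_zero]

end Triple

/-! ### Maps out of the triple tensor product -/

section Lift

variable {C D : FilteredComplex n}

/-- A product of two semilinear maps to a commutative ring descends to the tensor product. -/
theorem exists_mulLift {Y : Type} [CommRing Y] [Algebra ℚ Y] (μ : C.M →ₗ[ℚ] Y) (ν : D.M →ₗ[ℚ] Y)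
    (y z x : Fin n → Y) (hμy : ∀ k m, μ ((yv k : Pxy n) • m) = y k * μ m)
    (hμx : ∀ k m, μ ((xv k : Pxy n) • m) = z k * μ m)
    (hνy : ∀ k m, ν ((yv k : Pxy n) • m) = z k * ν m)
    (hνx : ∀ k m, ν ((xv k : Pxy n) • m) = x k * ν m) :
    ∃ ρ : (C.tensor D).M →ₗ[ℚ] Y, (∀ m m', ρ (tmk C D m m') = μ m * ν m') ∧
      (∀ k m, ρ ((yv k : Pxy n) • m) = y k * ρ m) ∧
      ∀ k m, ρ ((xv k : Pxy n) • m) = x k * ρ m := by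
  have hB : ∀ (k : Fin n) (m : C.M) (m' : D.M),
      ((LinearMap.mul ℚ Y).compl₁₂ μ ν) ((xv k : Pxy n) • m) m' =
        ((LinearMap.mul ℚ Y).compl₁₂ μ ν) m ((yv k : Pxy n) • m') := fun k m m' => by
    simp only [LinearMap.compl₁₂_apply, LinearMap.mul_apply', hμx, hνy]
    ring
  have h : ∀ m m', tensorLift _ hB (tmk C D m m') = μ m * ν m' := fun _ _ => rfl
  refine ⟨tensorLift _ hB, h, fun k m => ?_, fun k m => ?_⟩
  · induction m using tensor_induction with
    | zero => simp only [smul_zero, map_zero, mul_zero]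
    | add u v hu hv => rw [smul_add, map_add, hu, hv, map_add, mul_add]
    | tmk m m' => rw [yv_smul_tmk, h, h, hμy, mul_assoc]
  · induction m using tensor_induction with
    | zero => simp only [smul_zero, map_zero, mul_zero]
    | add u v hu hv => rw [smul_add, map_add, hu, hv, map_add, mul_add]
    | tmk m m' => rw [xv_smul_tmk, h, h, hνx, mul_left_comm]

/-- The largest ideal on which a linear functional on an algebra vanishes. -/
def kerIdeal {A T N : Type} [CommRing A] [CommRing T] [Algebra A T] [AddCommGroup N] [Module A N]
    (θ : T →ₗ[A] N) : Ideal T where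
  carrier := {t | ∀ s, θ (s * t) = 0}
  zero_mem' s := by rw [mul_zero, map_zero]
  add_mem' hu hv s := by rw [mul_add, map_add, hu s, hv s, add_zero]
  smul_mem' r t ht s := by rw [smul_eq_mul, ← mul_assoc]; exact ht _

/-- A linear functional descends to the quotient by `kerIdeal`. -/
theorem exists_kerIdeal_lift {A T N : Type} [CommRing A] [CommRing T] [Algebra A T]
    [AddCommGroup N] [Module A N] (θ : T →ₗ[A] N) :
    ∃ φ : T ⧸ kerIdeal θ →ₗ[A] N, ∀ t, φ (Ideal.Quotient.mk _ t) = θ t := by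
  have h : (kerIdeal θ).restrictScalars A ≤ LinearMap.ker θ := fun t ht => by
    have := ht 1
    rwa [one_mul] at this
  exact ⟨((kerIdeal θ).restrictScalars A).liftQ θ h ∘ₗ
    (Submodule.Quotient.restrictScalarsEquiv A (kerIdeal θ)).symm.toLinearMap, fun t => rfl⟩

variable {a b c : Fin n}

/-- A ring homomorphism `φ` from `ℚ[x, y]` that maps the ideal of a summand of a crossing to an
ideal `J` induces a semilinear map that is `1` on the generator of this summand and zero on the
other one. -/
theorem Crossing.exists_semilinear (X : Crossing C a b) {T : Type} [CommRing T] [Algebra ℚ T]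
    (J : Ideal T) (φ : Pxy n →ₐ[ℚ] T) (ε : Bool) (h : ∀ p ∈ crossIdeal a b ε, φ p ∈ J) :
    ∃ μ : C.M →ₗ[ℚ] T ⧸ J, (∀ p m, μ (p • m) = Ideal.Quotient.mk J (φ p) * μ m) ∧
      μ (X.e ε) = 1 ∧ ∀ δ, δ ≠ ε → μ (X.e δ) = 0 := by
  have h : crossIdeal a b ε ≤ J.comap φ := h
  refine ⟨(Ideal.quotientMapₐ J φ h).toLinearMap ∘ₗ (X.κ ε).restrictScalars ℚ,
    fun p m => ?_, ?_, fun δ hδ => ?_⟩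
  · obtain ⟨q, hq⟩ := Ideal.Quotient.mk_surjective (X.κ ε m)
    have hpq : X.κ ε (p • m) = Ideal.Quotient.mk _ (p * q) := by
      rw [map_smul, ← hq]; rfl
    simp only [LinearMap.comp_apply, LinearMap.restrictScalars_apply, hpq, ← hq]
    exact (congrArg (Ideal.Quotient.mk J) (map_mul φ p q)).trans (map_mul _ _ _)
  · rw [LinearMap.comp_apply, LinearMap.restrictScalars_apply, X.κ_same]
    exact map_one (Ideal.quotientMapₐ J φ h)
  · rw [LinearMap.comp_apply, LinearMap.restrictScalars_apply, X.κ_ne ε δ hδ.symm, map_zero]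

/-- The free `ℚ[x, y]`-algebra of rank two that is generated by the intermediate variable `t`. -/
abbrev MidRing (a b : Fin n) : Type :=
  QuadraticAlgebra (Pxy n) (-(yv a * yv b)) (yv a + yv b)

/-- The variables between the first two factors of the triple tensor product. -/
def zval (a b k : Fin n) : MidRing a b :=
  if k = a then ⟨0, 1⟩ else if k = b then ⟨yv a + yv b, -1⟩ else ⟨yv k, 0⟩

/-- The variables between the last two factors of the triple tensor product. -/
def wval (a b k : Fin n) : MidRing a b :=
  if k = a then ⟨0, 1⟩ else if k = b then ⟨xv a + xv b, -1⟩ else ⟨xv k, 0⟩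

variable {N : Type} [AddCommGroup N] [Module (Pxy n) N]

/-- The linear functional on `ℚ[x, y, t]` with values `v` at `1` and `v'` at `t`. -/
def midFunctional (a b : Fin n) (v v' : N) : MidRing a b →ₗ[Pxy n] N where
  toFun t := t.re • v + t.im • v'
  map_add' s t := by simp only [QuadraticAlgebra.re_add, QuadraticAlgebra.im_add]; module
  map_smul' p t := by
    simp only [QuadraticAlgebra.re_smul, QuadraticAlgebra.im_smul, smul_eq_mul, RingHom.id_apply]
    module

/-- An element is in the largest ideal in the kernel of the functional as soon as the functional
vanishes on it and on its multiple by the variable `t`. -/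
theorem mem_kerIdeal {v v' : N} {u : MidRing a b} (h : u.re • v + u.im • v' = 0)
    (h' : (-(yv a * yv b) * u.im) • v + (u.re + (yv a + yv b) * u.im) • v' = 0) :
    u ∈ kerIdeal (midFunctional a b v v') := by
  intro s
  change (s * u).re • v + (s * u).im • v' = 0
  rw [QuadraticAlgebra.re_mul, QuadraticAlgebra.im_mul]
  linear_combination (norm := module) s.re • h + s.im • h'

/-- The universal property of a single summand: `v` and `v'` are the images of the generator and
of its multiple by the intermediate variable `t`.

The pair `v`, `v'` is a linear functional `θ` on the ring `ℚ[x, y, t]` modulo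
`t ^ 2 = (y a + y b) t - y a y b`. Modulo the largest ideal in the kernel of `θ`, each factor of the
summand maps to this ring, and the product of the three maps followed by `θ` is the map that is
wanted. -/
theorem exists_lift_single (X : Crossing C a b) (Y : Crossing D b c) (hab : a ≠ b) (hac : a ≠ c)
    (hbc : b ≠ c) (ε₁ ε₂ ε₃ : Bool) {v v' : N} (h : BottRel a b c v v')
    (h₁ : ε₁ = false → v' = (yv a : Pxy n) • v)
    (h₂ : ε₂ = false → (yv c : Pxy n) • v = (xv c : Pxy n) • v ∧
      (yv c : Pxy n) • v' = (xv c : Pxy n) • v')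
    (h₃ : ε₃ = false → v' = (xv a : Pxy n) • v) :
    ∃ φ : (triple C D).M →ₗ[Pxy n] N, φ (gen X Y (ε₁, ε₂, ε₃)) = v ∧
      φ (zop C D a (gen X Y (ε₁, ε₂, ε₃))) = v' ∧ ∀ δ, δ ≠ (ε₁, ε₂, ε₃) →
        φ (gen X Y δ) = 0 ∧ φ (zop C D a (gen X Y δ)) = 0 := by
  set θ := midFunctional a b v v' with hθ
  -- the variables on the two sides of each factor, as elements of `ℚ[x, y, t]`
  let φ₁ : Pxy n →ₐ[ℚ] MidRing a b := MvPolynomial.aeval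
    (Sum.elim (zval a b) (fun k => algebraMap (Pxy n) _ (yv k)))
  let φ₂ : Pxy n →ₐ[ℚ] MidRing a b := MvPolynomial.aeval (Sum.elim (wval a b) (zval a b))
  let φ₃ : Pxy n →ₐ[ℚ] MidRing a b := MvPolynomial.aeval
    (Sum.elim (fun k => algebraMap (Pxy n) _ (xv k)) (wval a b))
  have φ₁x : ∀ k, φ₁ (xv k) = zval a b k := fun k => MvPolynomial.aeval_X _ _
  have φ₁y : ∀ k, φ₁ (yv k) = algebraMap (Pxy n) _ (yv k) := fun k => MvPolynomial.aeval_X _ _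
  have φ₂x : ∀ k, φ₂ (xv k) = wval a b k := fun k => MvPolynomial.aeval_X _ _
  have φ₂y : ∀ k, φ₂ (yv k) = zval a b k := fun k => MvPolynomial.aeval_X _ _
  have φ₃x : ∀ k, φ₃ (xv k) = algebraMap (Pxy n) _ (xv k) := fun k => MvPolynomial.aeval_X _ _
  have φ₃y : ∀ k, φ₃ (yv k) = wval a b k := fun k => MvPolynomial.aeval_X _ _
  have hI₁ : ∀ p ∈ crossIdeal a b ε₁, φ₁ p ∈ kerIdeal θ := by
    have hle : crossIdeal a b ε₁ ≤ (kerIdeal θ).comap φ₁ := by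
      cases ε₁
      · refine Ideal.span_le.2 ?_
        rintro _ ⟨k, rfl⟩
        rw [SetLike.mem_coe, Ideal.mem_comap, map_sub, φ₁x, φ₁y]
        have h₁ := h₁ rfl
        by_cases hka : k = a
        · subst hka
          apply mem_kerIdeal <;> simp [zval] <;> rw [h₁] <;> module
        by_cases hkb : k = b
        · subst hkb
          apply mem_kerIdeal <;> simp [zval, hka] <;> rw [h₁] <;> module
        · apply mem_kerIdeal <;> simp [zval, hka, hkb]
      · refine Ideal.span_le.2 ?_
        rintro _ ((rfl | rfl) | ⟨k, ⟨hka, hkb⟩, rfl⟩)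
        · simp only [SetLike.mem_coe, Ideal.mem_comap, map_sub, map_add, φ₁x, φ₁y]
          apply mem_kerIdeal <;> simp [zval, hab.symm]
        · simp only [SetLike.mem_coe, Ideal.mem_comap, map_sub, map_mul, φ₁x, φ₁y]
          apply mem_kerIdeal <;> simp [zval, hab.symm]
        · simp only [SetLike.mem_coe, Ideal.mem_comap, map_sub, φ₁x, φ₁y]
          apply mem_kerIdeal <;> simp [zval, hka, hkb]
    exact fun p hp => hle hp
  have hI₃ : ∀ p ∈ crossIdeal a b ε₃, φ₃ p ∈ kerIdeal θ := by
    have hle : crossIdeal a b ε₃ ≤ (kerIdeal θ).comap φ₃ := by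
      cases ε₃
      · refine Ideal.span_le.2 ?_
        rintro _ ⟨k, rfl⟩
        rw [SetLike.mem_coe, Ideal.mem_comap, map_sub, φ₃x, φ₃y]
        have h₃ := h₃ rfl
        have hq := h.quad
        by_cases hka : k = a
        · subst hka
          apply mem_kerIdeal <;> simp [wval]
          · rw [h₃]; module
          · rw [h₃] at hq ⊢; linear_combination (norm := module) hq
        by_cases hkb : k = b
        · subst hkb
          apply mem_kerIdeal <;> simp [wval, hka]
          · rw [h₃]; module
          · rw [h₃] at hq ⊢; linear_combination (norm := module) -hq
        · apply mem_kerIdeal <;> simp [wval, hka, hkb]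
      · refine Ideal.span_le.2 ?_
        rintro _ ((rfl | rfl) | ⟨k, ⟨hka, hkb⟩, rfl⟩)
        · simp only [SetLike.mem_coe, Ideal.mem_comap, map_sub, map_add, φ₃x, φ₃y]
          apply mem_kerIdeal <;> simp [wval, hab.symm]
        · simp only [SetLike.mem_coe, Ideal.mem_comap, map_sub, map_mul, φ₃x, φ₃y]
          apply mem_kerIdeal <;> simp [wval, hab.symm]
          · linear_combination (norm := module) -h.quad
          · linear_combination (norm := module) -h.quad'
        · simp only [SetLike.mem_coe, Ideal.mem_comap, map_sub, φ₃x, φ₃y]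
          apply mem_kerIdeal <;> simp [wval, hka, hkb]
    exact fun p hp => hle hp
  have hI₂ : ∀ p ∈ crossIdeal b c ε₂, φ₂ p ∈ kerIdeal θ := by
    have hle : crossIdeal b c ε₂ ≤ (kerIdeal θ).comap φ₂ := by
      cases ε₂
      · refine Ideal.span_le.2 ?_
        rintro _ ⟨k, rfl⟩
        rw [SetLike.mem_coe, Ideal.mem_comap, map_sub, φ₂x, φ₂y]
        obtain ⟨hv, hv'⟩ := h₂ rfl
        by_cases hka : k = a
        · subst hka
          apply mem_kerIdeal <;> simp [wval, zval]
        by_cases hkb : k = b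
        · subst hkb
          apply mem_kerIdeal <;> simp [wval, zval, hka]
          · linear_combination (norm := module) h.sum - hv
          · linear_combination (norm := module) h.sum' - hv'
        by_cases hkc : k = c
        · subst hkc
          apply mem_kerIdeal <;> simp [wval, zval, hka, hkb]
          · linear_combination (norm := module) hv
          · linear_combination (norm := module) hv'
        · apply mem_kerIdeal <;> simp [wval, zval, hka, hkb]
          · linear_combination (norm := module) h.other k hka hkb hkc
          · linear_combination (norm := module) h.other' k hka hkb hkc
      · refine Ideal.span_le.2 ?_
        rintro _ ((rfl | rfl) | ⟨k, ⟨hkb, hkc⟩, rfl⟩)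
        · simp only [SetLike.mem_coe, Ideal.mem_comap, map_sub, map_add, φ₂x, φ₂y]
          apply mem_kerIdeal <;> simp [wval, zval, hab.symm, hac.symm, hbc.symm]
          · linear_combination (norm := module) h.sum
          · linear_combination (norm := module) h.sum'
        · simp only [SetLike.mem_coe, Ideal.mem_comap, map_sub, map_mul, φ₂x, φ₂y]
          apply mem_kerIdeal <;> simp [wval, zval, hab.symm, hac.symm, hbc.symm]
          · linear_combination (norm := module) h.mid
          · linear_combination (norm := module) h.mid'
        · simp only [SetLike.mem_coe, Ideal.mem_comap, map_sub, φ₂x, φ₂y]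
          by_cases hka : k = a
          · subst hka
            apply mem_kerIdeal <;> simp [wval, zval]
          · apply mem_kerIdeal <;> simp [wval, zval, hka, hkb]
            · linear_combination (norm := module) h.other k hka hkb hkc
            · linear_combination (norm := module) h.other' k hka hkb hkc
    exact fun p hp => hle hp
  obtain ⟨μ₁, hμ₁, hμ₁e, hμ₁n⟩ := X.exists_semilinear _ φ₁ ε₁ hI₁
  obtain ⟨μ₂, hμ₂, hμ₂e, hμ₂n⟩ := Y.exists_semilinear _ φ₂ ε₂ hI₂
  obtain ⟨μ₃, hμ₃, hμ₃e, hμ₃n⟩ := X.exists_semilinear _ φ₃ ε₃ hI₃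
  obtain ⟨ν, hν, hνy, hνx⟩ := exists_mulLift μ₂ μ₃ _ _ _ (fun k m => hμ₂ (yv k) m)
    (fun k m => by rw [hμ₂ (xv k), φ₂x]) (fun k m => by rw [hμ₃ (yv k), φ₃y])
    (fun k m => hμ₃ (xv k) m)
  obtain ⟨ρ, hρ, hρy, hρx⟩ := exists_mulLift μ₁ ν _ _ _ (fun k m => hμ₁ (yv k) m)
    (fun k m => hμ₁ (xv k) m) (fun k m => by rw [hνy, φ₂y, φ₁x]) hνx
  obtain ⟨η, hη⟩ := exists_kerIdeal_lift θ
  have hρtri : ∀ m₁ m₂ m₃, ρ (tri m₁ m₂ m₃) = μ₁ m₁ * (μ₂ m₂ * μ₃ m₃) := fun m₁ m₂ m₃ => by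
    rw [tri, hρ, hν]
  have hρz : ∀ δ, ρ (zop C D a (gen X Y δ)) =
      Ideal.Quotient.mk _ (zval a b a) * ρ (gen X Y δ) := fun δ => by
    rw [gen, zop_tri, hρtri, hρtri, hμ₁, φ₁x, mul_assoc]
  have hρ0 : ∀ δ, δ ≠ (ε₁, ε₂, ε₃) → ρ (gen X Y δ) = 0 := by
    rintro ⟨δ₁, δ₂, δ₃⟩ hδ
    rw [gen, hρtri]
    by_cases h1 : δ₁ = ε₁
    · by_cases h2 : δ₂ = ε₂
      · by_cases h3 : δ₃ = ε₃
        · exact absurd (by rw [h1, h2, h3]) hδ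
        · rw [hμ₃n _ h3, mul_zero, mul_zero]
      · rw [hμ₂n _ h2, zero_mul, mul_zero]
    · rw [hμ₁n _ h1, zero_mul]
  have hρ1 : ρ (gen X Y (ε₁, ε₂, ε₃)) = 1 := by
    rw [gen, hρtri, hμ₁e, hμ₂e, hμ₃e, mul_one, mul_one]
  refine ⟨η ∘ₗ polyLinear ρ (fun k m => ?_) (fun k m => ?_), ?_, ?_, fun δ hδ => ⟨?_, ?_⟩⟩
  · rw [hρx, φ₃x, Algebra.smul_def]; rfl
  · rw [hρy, φ₁y, Algebra.smul_def]; rfl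
  · rw [LinearMap.comp_apply, polyLinear_apply, hρ1, ← map_one (Ideal.Quotient.mk _), hη]
    change (1 : Pxy n) • v + (0 : Pxy n) • v' = v
    module
  · rw [LinearMap.comp_apply, polyLinear_apply, hρz, hρ1, mul_one, hη, zval, if_pos rfl]
    change (0 : Pxy n) • v + (1 : Pxy n) • v' = v'
    module
  · rw [LinearMap.comp_apply, polyLinear_apply, hρ0 δ hδ, map_zero]
  · rw [LinearMap.comp_apply, polyLinear_apply, hρz, hρ0 δ hδ, mul_zero, map_zero]

/-- The value that a map out of the triple tensor product takes on the multiple of a generator by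
the intermediate variable. -/
def midVal (a : Fin n) (v : (Bool × Bool × Bool) ⊕ Bool → N) : Bool × Bool × Bool → N
  | (false, δ) => (yv a : Pxy n) • v (Sum.inl (false, δ))
  | (true, δ, false) => (xv a : Pxy n) • v (Sum.inl (true, δ, false))
  | (true, δ, true) => v (Sum.inr δ)

/-- The universal property of the triple tensor product. -/
theorem exists_lift (X : Crossing C a b) (Y : Crossing D b c) (hab : a ≠ b) (hac : a ≠ c)
    (hbc : b ≠ c) {v : (Bool × Bool × Bool) ⊕ Bool → N} (h : GenRel a b c v) :
    ∃ φ : (triple C D).M →ₗ[Pxy n] N, ∀ i, φ (genFamily X Y i) = v i := by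
  have hca : c ≠ a ∧ c ≠ b := ⟨hac.symm, hbc.symm⟩
  have key : ∀ ε : Bool × Bool × Bool, ∃ φ : (triple C D).M →ₗ[Pxy n] N,
      φ (gen X Y ε) = v (Sum.inl ε) ∧ φ (zop C D a (gen X Y ε)) = midVal a v ε ∧
        ∀ δ, δ ≠ ε → φ (gen X Y δ) = 0 ∧ φ (zop C D a (gen X Y δ)) = 0 := by
    rintro ⟨ε₁, ε₂, ε₃⟩
    apply exists_lift_single X Y hab hac hbc
    · cases ε₁ <;> cases ε₂ <;> cases ε₃
      · exact ((h.fff.blobRel a b).chainRel' hca).bottRel'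
      · exact (h.fft.chainRel' hca).bottRel'
      · exact (h.ftf.symm.chainRel ⟨hac, hab⟩).bottRel'
      · exact h.ftt.bottRel'
      · exact (h.tff.chainRel hca).bottRel
      · exact h.tft.bottRel h.tft' hca
      · exact h.ttf.bottRel
      · exact h.ttt
    · rintro rfl; rfl
    · rintro rfl
      have hs : ∀ {w : N} (p : Pxy n), BlobRel a b w →
          (yv c : Pxy n) • p • w = (xv c : Pxy n) • p • w :=
        fun p hw => (hw.smul p).other c hca.1 hca.2
      cases ε₁ <;> cases ε₃
      · exact ⟨h.fff c, hs _ (h.fff.blobRel a b)⟩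
      · exact ⟨h.fft.other c hca.1 hca.2, hs _ h.fft⟩
      · exact ⟨h.tff.other c hca.1 hca.2, hs _ h.tff⟩
      · exact ⟨h.tft.other c hca.1 hca.2, h.tft'.other c hca.1 hca.2⟩
    · rintro rfl
      cases ε₁ <;> cases ε₂
      · exact h.fff a
      · exact h.ftf.other a hab hac
      · rfl
      · rfl
  choose φ hφ hφz hφ0 using key
  refine ⟨∑ ε, φ ε, ?_⟩
  rintro (ε | δ)
  · rw [genFamily, LinearMap.sum_apply, Finset.sum_eq_single ε (fun δ _ hδ => (hφ0 δ ε hδ.symm).1)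
      (fun h => absurd (Finset.mem_univ _) h), hφ]
  · rw [genFamily, LinearMap.sum_apply, Finset.sum_eq_single (true, δ, true)
      (fun ε _ hε => (hφ0 ε _ hε.symm).2) (fun h => absurd (Finset.mem_univ _) h), hφz, midVal]

end Lift

/-! ### The homotopy equivalence -/

section Braid

variable {C D : FilteredComplex n} {a b c : Fin n}

theorem d_gen (X : Crossing C a b) (Y : Crossing D b c) :
    ((triple C D).d (gen X Y (true, true, true)) = gen X Y (false, true, true) -
      gen X Y (true, false, true) + gen X Y (true, true, false)) ∧
    ((triple C D).d (gen X Y (false, true, true)) = gen X Y (false, false, true) -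
      gen X Y (false, true, false)) ∧
    ((triple C D).d (gen X Y (true, false, true)) = gen X Y (false, false, true) -
      gen X Y (true, false, false)) ∧
    ((triple C D).d (gen X Y (true, true, false)) = gen X Y (false, true, false) -
      gen X Y (true, false, false)) ∧
    ((triple C D).d (gen X Y (false, false, true)) = gen X Y (false, false, false)) ∧
    ((triple C D).d (gen X Y (false, true, false)) = gen X Y (false, false, false)) ∧
    ((triple C D).d (gen X Y (true, false, false)) = gen X Y (false, false, false)) ∧
    (triple C D).d (gen X Y (false, false, false)) = 0 := by
  have hl : ∀ m₁ (m₂ : D.M) m₃, tri (C := C) (-m₁) m₂ m₃ = -tri m₁ m₂ m₃ := fun m₁ m₂ m₃ => by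
    rw [← neg_one_smul ℚ, tri, tmk_smul_left, neg_one_smul, tri]
  have hm : ∀ m₁ (m₂ : D.M) m₃, tri (C := C) m₁ (-m₂) m₃ = -tri m₁ m₂ m₃ := fun m₁ m₂ m₃ => by
    rw [← neg_one_smul ℚ, tri, tmk_smul_left, tmk_smul_right, neg_one_smul, tri]
  have h1 : ∀ (m₂ : D.M) m₃, tri (C := C) 0 m₂ m₃ = 0 := fun m₂ m₃ => tmk_zero_left _
  have h2 : ∀ m₁ m₃, tri (C := C) (D := D) m₁ 0 m₃ = 0 := fun m₁ m₃ => by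
    rw [tri, tmk_zero_left, tmk_zero_right]
  have h3 : ∀ m₁ (m₂ : D.M), tri (C := C) m₁ m₂ 0 = 0 := fun m₁ m₂ => by
    rw [tri, tmk_zero_right, tmk_zero_right]
  refine ⟨?_, ?_, ?_, ?_, ?_, ?_, ?_, ?_⟩ <;>
    simp only [gen, d_tri, X.d_true, X.d_false, Y.d_true, Y.d_false, X.sgn_true, X.sgn_false,
      Y.sgn_true, Y.sgn_false, hl, hm, h1, h2, h3] <;> abel

/-- The degrees of the generators of the triple tensor product. -/
def genDeg : (Bool × Bool × Bool) ⊕ Bool → ℤ × ℤ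
  | Sum.inl (ε₁, ε₂, ε₃) => (ε₁.toNat + ε₂.toNat + ε₃.toNat, 0)
  | Sum.inr δ => (2 + δ.toNat, 2)

theorem tri_mem_gr {p q r s : ℤ × ℤ} (h : p + q + r = s) {m₁ : C.M} {m₂ : D.M} {m₃ : C.M}
    (h₁ : m₁ ∈ C.gr p) (h₂ : m₂ ∈ D.gr q) (h₃ : m₃ ∈ C.gr r) :
    tri m₁ m₂ m₃ ∈ (triple C D).gr s :=
  tmk_mem_gr (a := p) (b := q + r) (by rw [← h, add_assoc]) h₁ (tmk_mem_gr rfl h₂ h₃)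

theorem Crossing.e_mem_gr (X : Crossing C a b) (ε : Bool) : X.e ε ∈ C.gr (ε.toNat, 0) := by
  cases ε
  · exact X.gr_false
  · exact X.gr_true

theorem gen_mem_gr (X : Crossing C a b) (Y : Crossing D b c) (ε₁ ε₂ ε₃ : Bool) :
    gen X Y (ε₁, ε₂, ε₃) ∈ (triple C D).gr (ε₁.toNat + ε₂.toNat + ε₃.toNat, 0) :=
  tri_mem_gr (by simp) (X.e_mem_gr ε₁) (Y.e_mem_gr ε₂) (X.e_mem_gr ε₃)

theorem genFamily_mem_gr (X : Crossing C a b) (Y : Crossing D b c)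
    (i : (Bool × Bool × Bool) ⊕ Bool) : genFamily X Y i ∈ (triple C D).gr (genDeg i) := by
  rcases i with ⟨ε₁, ε₂, ε₃⟩ | δ
  · exact gen_mem_gr X Y ε₁ ε₂ ε₃
  · change zop C D a (tri _ _ _) ∈ _
    rw [zop_tri, xv_smul]
    refine tri_mem_gr ?_ (C.gr_r a _ _ (X.e_mem_gr true)) (Y.e_mem_gr δ) (X.e_mem_gr true)
    simp only [genDeg, Prod.mk_add_mk, Bool.toNat_true]
    refine Prod.ext ?_ ?_
    · push_cast; ring
    · norm_num

/-- The values on the generators of the map from `C ⊗ D ⊗ C` to `D ⊗ C ⊗ D`. In homological degree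
three it sends the intermediate variable to `x a + x b - y c`, so that it vanishes on the copy of
the blob bimodule that is cancelled there. The other cancelled summand, generated by the
vertex `(true, false, true)`, goes to zero as well, so that the vertices `(false, false, true)` and
`(true, false, false)`, whose difference is the boundary of that generator, have the same value. The
value on the multiple of `(true, false, true)` by the intermediate variable is determined by the
differential of the same multiple of `(true, true, true)`. -/
def braidVal (X : Crossing C a b) (Y : Crossing D b c) :
    (Bool × Bool × Bool) ⊕ Bool → (triple D C).M
  | Sum.inl (true, true, true) => gen Y.symm X.symm (true, true, true)
  | Sum.inr true => (xv a + xv b - yv c : Pxy n) • gen Y.symm X.symm (true, true, true)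
  | Sum.inl (false, true, true) =>
    gen Y.symm X.symm (true, true, false) - gen Y.symm X.symm (true, false, true)
  | Sum.inl (true, true, false) => gen Y.symm X.symm (false, true, true)
  | Sum.inl (true, false, true) => 0
  | Sum.inr false => (xv c - yv b : Pxy n) •
      (gen Y.symm X.symm (true, true, false) - gen Y.symm X.symm (true, false, true)) +
    (yv c - xv b : Pxy n) • gen Y.symm X.symm (false, true, true)
  | Sum.inl (false, false, true) => gen Y.symm X.symm (false, true, false)
  | Sum.inl (true, false, false) => gen Y.symm X.symm (false, true, false)
  | Sum.inl (false, true, false) => gen Y.symm X.symm (false, false, true)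
  | Sum.inl (false, false, false) => gen Y.symm X.symm (false, false, false)

/-- The values of the homotopy on the generators. It inverts the two components of the
differential that are cancelled: from the copy of the blob bimodule in the triple product of blob
bimodules to the corresponding summand in homological degree two, and from the other summand there
to one of the two blob bimodules in homological degree one. -/
def homotopyVal (X : Crossing C a b) (Y : Crossing D b c) :
    (Bool × Bool × Bool) ⊕ Bool → (triple C D).M
  | Sum.inr false => zop C D a (gen X Y (true, true, true)) -
      (xv a + xv b - yv c : Pxy n) • gen X Y (true, true, true)
  | Sum.inl (true, false, false) => gen X Y (true, false, true)
  | _ => 0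

theorem chainRel_sub (X : Crossing C a b) (Y : Crossing D b c) (hab : a ≠ b) (hac : a ≠ c)
    (hbc : b ≠ c) : ChainRel c b a
      (gen Y.symm X.symm (true, true, false) - gen Y.symm X.symm (true, false, true)) :=
  (chainRel_gen_of_right Y.symm X.symm hbc.symm hac.symm hab.symm _ _).sub
    ((blobRel_of_mid Y.symm X.symm _ _).chainRel ⟨hac, hab⟩)

theorem genRel_braidVal (X : Crossing C a b) (Y : Crossing D b c) (hab : a ≠ b) (hac : a ≠ c)
    (hbc : b ≠ c) : GenRel a b c (braidVal X Y) where
  ttt := (bottRel_zop Y.symm X.symm hbc.symm hac.symm hab.symm _).symRel.reverse.bottRel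
  ftt := chainRel_sub X Y hab hac hbc
  tft := blobRel_zero a b
  tft' := (chainRel_sub X Y hab hac hbc).blobRel'.add'
    (chainRel_gen_of_left Y.symm X.symm hbc.symm hac.symm hab.symm _).blobRel
  ttf := chainRel_gen_of_left Y.symm X.symm hbc.symm hac.symm hab.symm _
  fft := (blobRel_gen_outer Y.symm X.symm true).symm
  ftf := (blobRel_of_mid Y.symm X.symm _ _).symm
  tff := (blobRel_gen_outer Y.symm X.symm true).symm
  fff := idRel_gen Y.symm X.symm

theorem genRel_homotopyVal (X : Crossing C a b) (Y : Crossing D b c) (hab : a ≠ b) (hac : a ≠ c)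
    (hbc : b ≠ c) : GenRel a b c (homotopyVal X Y) where
  ttt := (blobRel_zero a b).bottRel (blobRel_zero a b) ⟨hac.symm, hbc.symm⟩
  ftt := (blobRel_zero a b).chainRel' ⟨hac.symm, hbc.symm⟩
  tft := blobRel_zero a b
  tft' := (bottRel_zop X Y hab hac hbc _).blobRel
  ttf := (blobRel_zero a b).chainRel ⟨hac.symm, hbc.symm⟩
  fft := blobRel_zero a b
  ftf := blobRel_zero b c
  tff := blobRel_of_mid X Y _ _
  fff := idRel_zero

theorem braidVal_mem_gr (X : Crossing C a b) (Y : Crossing D b c)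
    (i : (Bool × Bool × Bool) ⊕ Bool) :
    braidVal X Y i ∈ (triple D C).gr (genDeg i + (0, 0)) := by
  have hg : ∀ ε₁ ε₂ ε₃ (s : ℤ × ℤ), ((ε₁.toNat + ε₂.toNat + ε₃.toNat, 0) : ℤ × ℤ) = s →
      gen Y.symm X.symm (ε₁, ε₂, ε₃) ∈ (triple D C).gr s := by
    rintro ε₁ ε₂ ε₃ _ rfl
    exact gen_mem_gr _ _ _ _ _
  have hs : ∀ (p : Pxy n) (m : (triple D C).M) (s : ℤ), p ∈ polyGr n 2 →
      m ∈ (triple D C).gr (s, 0) → p • m ∈ (triple D C).gr (s, 2) := by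
    intro p m s hp hm
    simpa using (triple D C).smul_mem_gr hp hm
  rcases i with ⟨ε₁, ε₂, ε₃⟩ | δ
  · cases ε₁ <;> cases ε₂ <;> cases ε₃
    on_goal 6 => exact zero_mem _
    on_goal 4 => exact sub_mem (hg _ _ _ _ rfl) (hg _ _ _ _ rfl)
    all_goals exact hg _ _ _ _ rfl
  · have h2 : ∀ k l, (MvPolynomial.X k - MvPolynomial.X l : Pxy n) ∈ polyGr n 2 := fun k l =>
      sub_mem (X_mem_polyGr k) (X_mem_polyGr l)
    cases δ
    · have h₁ : gen Y.symm X.symm (true, true, false) - gen Y.symm X.symm (true, false, true) ∈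
          (triple D C).gr ((2 : ℤ), 0) :=
        Submodule.sub_mem _ (hg _ _ _ _ (by simp)) (hg _ _ _ _ (by simp))
      have h₃ : gen Y.symm X.symm (false, true, true) ∈ (triple D C).gr ((2 : ℤ), 0) :=
        hg _ _ _ _ (by simp)
      have h₄ := Submodule.add_mem _ (hs (xv c - yv b) _ 2 (h2 _ _) h₁)
        (hs (yv c - xv b) _ 2 (h2 _ _) h₃)
      exact h₄
    · rw [show genDeg (Sum.inr true) + (0, 0) = ((3 : ℤ), (2 : ℤ)) from rfl]
      exact hs (xv a + xv b - yv c) _ 3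
        (sub_mem (add_mem (X_mem_polyGr _) (X_mem_polyGr _)) (X_mem_polyGr _))
        (hg _ _ _ _ (by simp))

theorem homotopyVal_mem_gr (X : Crossing C a b) (Y : Crossing D b c)
    (i : (Bool × Bool × Bool) ⊕ Bool) :
    homotopyVal X Y i ∈ (triple C D).gr (genDeg i + (1, 0)) := by
  rcases i with ⟨ε₁, ε₂, ε₃⟩ | δ
  · cases ε₁ <;> cases ε₂ <;> cases ε₃
    on_goal 5 => exact genFamily_mem_gr X Y (Sum.inl (true, false, true))
    all_goals exact zero_mem _
  · cases δ
    · have h₁ : zop C D a (gen X Y (true, true, true)) ∈ (triple C D).gr ((3 : ℤ), (2 : ℤ)) :=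
        genFamily_mem_gr X Y (Sum.inr true)
      have h₂ : gen X Y (true, true, true) ∈ (triple C D).gr ((3 : ℤ), (0 : ℤ)) :=
        gen_mem_gr X Y true true true
      have hp : (xv a + xv b - yv c : Pxy n) ∈ polyGr n 2 :=
        Submodule.sub_mem _ (Submodule.add_mem _ (X_mem_polyGr _) (X_mem_polyGr _))
          (X_mem_polyGr _)
      have h₃ : (xv a + xv b - yv c : Pxy n) • gen X Y (true, true, true) ∈
          (triple C D).gr ((3 : ℤ), (2 : ℤ)) := by
        simpa using (triple C D).smul_mem_gr hp h₂
      exact Submodule.sub_mem _ h₁ h₃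
    · exact zero_mem _

/-- The map between the two triple tensor products commutes with the differentials. -/
theorem braidMap_d (X : Crossing C a b) (Y : Crossing D b c) (hab : a ≠ b) (hac : a ≠ c)
    (hbc : b ≠ c) {f : (triple C D).M →ₗ[Pxy n] (triple D C).M}
    (hf : ∀ i, f (genFamily X Y i) = braidVal X Y i) (m : (triple C D).M) :
    f ((triple C D).d m) = (triple D C).d (f m) := by
  suffices h : f ∘ₗ (triple C D).dP = (triple D C).dP ∘ₗ f from LinearMap.congr_fun h m
  refine LinearMap.ext_on_range (span_genFamily X Y hab hac) fun i => ?_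
  rw [LinearMap.comp_apply, LinearMap.comp_apply, hf]
  have hS := (chainRel_sub X Y hab hac hbc).sum
  have hQ : (yv c + yv b : Pxy n) • gen Y.symm X.symm (false, false, true) =
      (xv c + xv b : Pxy n) • gen Y.symm X.symm (false, false, true) :=
    (blobRel_of_mid Y.symm X.symm _ _).add
  have hP := blobRel_gen_outer Y.symm X.symm true
  obtain ⟨d₁, d₂, d₃, d₄, d₅, d₆, d₇, d₈⟩ := d_gen X Y
  obtain ⟨d₁', d₂', d₃', d₄', d₅', d₆', d₇', d₈'⟩ := d_gen Y.symm X.symm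
  simp only [← dP_apply] at *
  have hfg : ∀ ε, f (gen X Y ε) = braidVal X Y (Sum.inl ε) := fun ε => hf (Sum.inl ε)
  have hft : ∀ δ, f (zop C D a (gen X Y (true, δ, true))) = braidVal X Y (Sum.inr δ) :=
    fun δ => hf (Sum.inr δ)
  rcases i with ⟨ε₁, ε₂, ε₃⟩ | δ
  · cases ε₁ <;> cases ε₂ <;> cases ε₃ <;>
      simp only [genFamily, braidVal, map_add, map_sub, map_zero, *] <;> abel
  · have hz : ∀ m, (triple C D).dP (zop C D a m) = zop C D a ((triple C D).dP m) := d_zop a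
    cases δ
    · simp only [genFamily, hz, d₃, map_sub, zop_gen_of_left,
        zop_gen_of_right X Y hab hac, map_smul, hfg, braidVal, map_add, d₂', d₃', d₄']
      linear_combination (norm := module) hP.add + hP.other c hbc.symm hac.symm - hQ
    · simp only [genFamily, hz, d₁, map_sub, map_add, zop_gen_of_left,
        zop_gen_of_right X Y hab hac, map_smul, hfg, hft, braidVal, d₁']
      linear_combination (norm := module) hS

/-- The composition of the two maps is homotopic to the identity. -/
theorem braidMap_comp (X : Crossing C a b) (Y : Crossing D b c) (hab : a ≠ b) (hac : a ≠ c)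
    (hbc : b ≠ c) {f : (triple C D).M →ₗ[Pxy n] (triple D C).M}
    {g : (triple D C).M →ₗ[Pxy n] (triple C D).M} {h : (triple C D).M →ₗ[Pxy n] (triple C D).M}
    (hf : ∀ i, f (genFamily X Y i) = braidVal X Y i)
    (hg : ∀ i, g (genFamily Y.symm X.symm i) = braidVal Y.symm X.symm i)
    (hh : ∀ i, h (genFamily X Y i) = homotopyVal X Y i) (m : (triple C D).M) :
    g (f m) - m = (triple C D).d (h m) + h ((triple C D).d m) := by
  suffices H : g ∘ₗ f - LinearMap.id = (triple C D).dP ∘ₗ h + h ∘ₗ (triple C D).dP from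
    LinearMap.congr_fun H m
  refine LinearMap.ext_on_range (span_genFamily X Y hab hac) fun i => ?_
  rw [LinearMap.sub_apply, LinearMap.add_apply, LinearMap.comp_apply, LinearMap.comp_apply,
    LinearMap.comp_apply, LinearMap.id_apply, hf, hh]
  have hS := (chainRel_gen_of_left X Y hab hac hbc (true, true)).sum
  obtain ⟨d₁, d₂, d₃, d₄, d₅, d₆, d₇, d₈⟩ := d_gen X Y
  simp only [← dP_apply] at *
  have hgg : ∀ ε, g (gen Y.symm X.symm ε) = braidVal Y.symm X.symm (Sum.inl ε) :=
    fun ε => hg (Sum.inl ε)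
  have hhg : ∀ ε, h (gen X Y ε) = homotopyVal X Y (Sum.inl ε) := fun ε => hh (Sum.inl ε)
  have hht : ∀ δ, h (zop C D a (gen X Y (true, δ, true))) = homotopyVal X Y (Sum.inr δ) :=
    fun δ => hh (Sum.inr δ)
  have hss : ∀ ε, gen X.symm.symm Y.symm.symm ε = gen X Y ε := fun _ => rfl
  have hz : ∀ m, (triple C D).dP (zop C D a m) = zop C D a ((triple C D).dP m) := d_zop a
  rcases i with ⟨ε₁, ε₂, ε₃⟩ | δ
  · cases ε₁ <;> cases ε₂ <;> cases ε₃ <;>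
      simp only [genFamily, braidVal, homotopyVal, map_add, map_sub, map_zero, hgg, hhg, hss,
        d₁, d₂, d₃, d₄, d₅, d₆, d₇, d₈] <;> abel
  · cases δ
    · simp only [genFamily, hz, d₁, d₃, map_sub, map_add, zop_gen_of_left, map_smul,
        zop_gen_of_right X Y hab hac, hgg, hhg, hss, braidVal, homotopyVal]
      linear_combination (norm := module) -hS
    · simp only [genFamily, hz, d₁, map_sub, map_add, zop_gen_of_left, map_smul,
        zop_gen_of_right X Y hab hac, hgg, hhg, hht, hss, braidVal, homotopyVal, map_zero]
      module

end Braid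

/-! ### The filtration -/

section Filtration

variable {C D : FilteredComplex n} {a b c : Fin n}

theorem triple_fil_zero (X : Crossing C a b) (Y : Crossing D b c) : (triple C D).fil 0 = ⊤ := by
  rw [eq_top_iff]
  intro x _
  induction x using tensor_induction with
  | zero => exact zero_mem _
  | add x y hx hy => exact add_mem (hx trivial) (hy trivial)
  | tmk m₁ x =>
    refine tmk_mem_fil (zero_add 0) (X.fil_zero ▸ Submodule.mem_top) ?_
    induction x using tensor_induction with
    | zero => exact zero_mem _
    | add x y hx hy => exact add_mem (hx trivial) (hy trivial)
    | tmk m₂ m₃ =>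
      exact tmk_mem_fil (zero_add 0) (Y.fil_zero ▸ Submodule.mem_top)
        (X.fil_zero ▸ Submodule.mem_top)

theorem Crossing.eq_zero_of_mem_fil (X : Crossing C a b) {i : ℤ} (hi : 2 ≤ i) {m : C.M}
    (hm : m ∈ C.fil i) : m = 0 := by
  have := C.fil_antitone hi hm
  rwa [X.fil_two, Submodule.mem_bot] at this

/-- In the tensor product, `y k - x k` is the sum of the differences of the variables on the two
sides of each factor. -/
theorem sub_smul_tmk (k : Fin n) (m : C.M) (m' : D.M) :
    (yv k - xv k : Pxy n) • tmk C D m m' =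
      tmk C D ((yv k - xv k : Pxy n) • m) m' + tmk C D m ((yv k - xv k : Pxy n) • m') := by
  have h : ∀ m m' : C.M, ∀ d : D.M, tmk C D (m - m') d = tmk C D m d - tmk C D m' d :=
    fun m m' d => by rw [eq_sub_iff_add_eq, ← tmk_add_left, sub_add_cancel]
  have h' : ∀ m : C.M, ∀ d d' : D.M, tmk C D m (d - d') = tmk C D m d - tmk C D m d' :=
    fun m d d' => by rw [eq_sub_iff_add_eq, ← tmk_add_right, sub_add_cancel]
  rw [sub_smul, sub_smul, sub_smul, h, h', yv_smul_tmk, xv_smul_tmk, xv_smul_tmk_left]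
  abel

theorem sub_smul_mem_triple_fil (X : Crossing C a b) (Y : Crossing D b c) (k : Fin n)
    (m : (triple C D).M) : (yv k - xv k : Pxy n) • m ∈ (triple C D).fil 1 := by
  have hX : ∀ m, m ∈ C.fil 0 := fun m => X.fil_zero ▸ Submodule.mem_top
  have hY : ∀ m, m ∈ D.fil 0 := fun m => Y.fil_zero ▸ Submodule.mem_top
  induction m using tensor_induction with
  | zero => rw [smul_zero]; exact zero_mem _
  | add x y hx hy => rw [smul_add]; exact add_mem hx hy
  | tmk m₁ x =>
    induction x using tensor_induction with
    | zero => rw [tmk_zero_right, smul_zero]; exact zero_mem _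
    | add x y hx hy => rw [tmk_add_right, smul_add]; exact add_mem hx hy
    | tmk m₂ m₃ =>
      rw [sub_smul_tmk, sub_smul_tmk]
      exact add_mem
        (tmk_mem_fil (add_zero 1) (X.sub_smul_mem_fil k _)
          (tmk_mem_fil (add_zero 0) (hY _) (hX _)))
        (tmk_mem_fil (zero_add 1) (hX _) (add_mem
          (tmk_mem_fil (add_zero 1) (Y.sub_smul_mem_fil k _) (hX _))
          (tmk_mem_fil (zero_add 1) (hY _) (X.sub_smul_mem_fil k _))))

/-- The third filtration step is spanned by pure tensors of elements of the first filtration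
steps, and on the middle factor `y c - x c` generates this step; on the outer factors it acts as
zero. -/
theorem exists_of_mem_triple_fil (X : Crossing C a b) (Y : Crossing D b c) (hac : a ≠ c)
    (hbc : b ≠ c) {i : ℤ} (hi : 3 ≤ i) {m : (triple C D).M} (hm : m ∈ (triple C D).fil i) :
    (∃ m', m = (yv c - xv c : Pxy n) • m') ∧ (4 ≤ i → m = 0) := by
  have hX0 : ∀ m : C.M, (yv c - xv c : Pxy n) • m = 0 := fun m => by
    rw [sub_smul, X.smul_eq hac.symm hbc.symm, sub_self]
  have inner : ∀ j : ℤ, 2 ≤ j → ∀ x ∈ (D.tensor C).fil j,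
      (∃ x', x = (yv c - xv c : Pxy n) • x') ∧ (3 ≤ j → x = 0) := by
    intro j hj x hx
    let K : Submodule ℚ (D.tensor C).M :=
      if 3 ≤ j then ⊥ else
        (LinearMap.range (LinearMap.lsmul (Pxy n) (D.tensor C).M
          (yv c - xv c))).restrictScalars ℚ
    have hK : (D.tensor C).fil j ≤ K := by
      refine tensor_fil_le fun p q hpq m₂ h₂ m₃ h₃ => ?_
      -- only `p = q = 1` contributes, as filtration two of both factors is zero
      by_cases hp : 2 ≤ p
      · rw [Y.eq_zero_of_mem_fil hp h₂, tmk_zero_left]; exact zero_mem _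
      by_cases hq : 2 ≤ q
      · rw [X.eq_zero_of_mem_fil hq h₃, tmk_zero_right]; exact zero_mem _
      have hp1 : p = 1 := by omega
      subst hp1
      obtain ⟨m₂, rfl⟩ := Y.exists_of_mem_fil c (Or.inr rfl) _ h₂
      simp only [K, if_neg (show ¬ 3 ≤ j by omega)]
      refine ⟨tmk D C m₂ m₃, ?_⟩
      rw [LinearMap.lsmul_apply, sub_smul_tmk, hX0, tmk_zero_right, add_zero]
    have hx' := hK hx
    by_cases h3 : 3 ≤ j
    · rw [show K = ⊥ from if_pos h3, Submodule.mem_bot] at hx'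
      exact ⟨⟨0, by rw [hx', smul_zero]⟩, fun _ => hx'⟩
    · rw [show K = _ from if_neg h3] at hx'
      obtain ⟨x', rfl⟩ := hx'
      exact ⟨⟨x', rfl⟩, fun h => absurd h h3⟩
  let K : Submodule ℚ (triple C D).M :=
    if 4 ≤ i then ⊥ else
      (LinearMap.range (LinearMap.lsmul (Pxy n) (triple C D).M (yv c - xv c))).restrictScalars ℚ
  have hK : (triple C D).fil i ≤ K := by
    refine tensor_fil_le fun p q hpq m₁ h₁ x hx => ?_
    by_cases hp : 2 ≤ p
    · rw [X.eq_zero_of_mem_fil hp h₁, tmk_zero_left]; exact zero_mem _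
    obtain ⟨⟨x', rfl⟩, h0⟩ := inner q (by omega) x hx
    by_cases hq : 3 ≤ q
    · rw [h0 hq, tmk_zero_right]; exact zero_mem _
    simp only [K, if_neg (show ¬ 4 ≤ i by omega)]
    refine ⟨tmk C (D.tensor C) m₁ x', ?_⟩
    rw [LinearMap.lsmul_apply, sub_smul_tmk, hX0, tmk_zero_left, zero_add]
  have hm' := hK hm
  by_cases h4 : 4 ≤ i
  · rw [show K = ⊥ from if_pos h4, Submodule.mem_bot] at hm'
    exact ⟨⟨0, by rw [hm', smul_zero]⟩, fun _ => hm'⟩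
  · rw [show K = _ from if_neg h4] at hm'
    obtain ⟨m', rfl⟩ := hm'
    exact ⟨⟨m', rfl⟩, fun h => absurd h h4⟩

/-- Every map of bimodules between the two triple products violates the filtration by at most two
units: nothing lies in filtration four, and filtration three consists of multiples of
`y c - x c`, which raises filtration zero to filtration one. -/
theorem violates_two (X : Crossing C a b) (Y : Crossing D b c) (hac : a ≠ c) (hbc : b ≠ c)
    (f : (triple C D).M →ₗ[Pxy n] (triple D C).M) : Violates 2 (f.restrictScalars ℚ) := by
  intro i m hm
  rw [LinearMap.restrictScalars_apply]
  rcases lt_trichotomy i 3 with hi | rfl | hi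
  · refine (triple D C).fil_antitone (show i - 2 ≤ 0 by omega) ?_
    rw [triple_fil_zero Y.symm X.symm]
    exact Submodule.mem_top
  · obtain ⟨⟨m', rfl⟩, -⟩ := exists_of_mem_triple_fil X Y hac hbc le_rfl hm
    rw [map_smul]
    exact sub_smul_mem_triple_fil Y.symm X.symm c _
  · rw [(exists_of_mem_triple_fil X Y hac hbc hi.le hm).2 hi, map_zero]
    exact zero_mem _

end Filtration

/-! ### The braid relation -/

/-- The braid relation for any two complexes with the properties in `Crossing`. -/
theorem exists_homotopyEquiv {C D : FilteredComplex n} {a b c : Fin n} (X : Crossing C a b)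
    (Y : Crossing D b c) (hab : a ≠ b) (hac : a ≠ c) (hbc : b ≠ c) :
    ∃ e : HomotopyEquiv (triple C D) (triple D C), Violates 2 e.f ∧ Violates 2 e.g := by
  obtain ⟨f, hf⟩ := exists_lift X Y hab hac hbc (genRel_braidVal X Y hab hac hbc)
  obtain ⟨g, hg⟩ := exists_lift Y.symm X.symm hbc.symm hac.symm hab.symm
    (genRel_braidVal Y.symm X.symm hbc.symm hac.symm hab.symm)
  obtain ⟨h, hh⟩ := exists_lift X Y hab hac hbc (genRel_homotopyVal X Y hab hac hbc)
  obtain ⟨k, hk⟩ := exists_lift Y.symm X.symm hbc.symm hac.symm hab.symm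
    (genRel_homotopyVal Y.symm X.symm hbc.symm hac.symm hab.symm)
  exact ⟨{
    f := f.restrictScalars ℚ
    g := g.restrictScalars ℚ
    hC := h.restrictScalars ℚ
    hD := k.restrictScalars ℚ
    f_bim := isBimoduleMap_restrictScalars f
    g_bim := isBimoduleMap_restrictScalars g
    hC_bim := isBimoduleMap_restrictScalars h
    hD_bim := isBimoduleMap_restrictScalars k
    f_deg := hasDegree_of_generators _ genDeg (genFamily_mem_gr X Y)
      (span_genFamily X Y hab hac) 0 f fun i => hf i ▸ braidVal_mem_gr X Y i
    g_deg := hasDegree_of_generators _ genDeg (genFamily_mem_gr Y.symm X.symm)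
      (span_genFamily Y.symm X.symm hbc.symm hac.symm) 0 g
      fun i => hg i ▸ braidVal_mem_gr Y.symm X.symm i
    hC_deg := hasDegree_of_generators _ genDeg (genFamily_mem_gr X Y)
      (span_genFamily X Y hab hac) 1 h fun i => hh i ▸ homotopyVal_mem_gr X Y i
    hD_deg := hasDegree_of_generators _ genDeg (genFamily_mem_gr Y.symm X.symm)
      (span_genFamily Y.symm X.symm hbc.symm hac.symm) 1 k
      fun i => hk i ▸ homotopyVal_mem_gr Y.symm X.symm i
    f_d := braidMap_d X Y hab hac hbc hf
    g_d := braidMap_d Y.symm X.symm hbc.symm hac.symm hab.symm hg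
    g_f := braidMap_comp X Y hab hac hbc hf hg hh
    f_g := braidMap_comp Y.symm X.symm hbc.symm hac.symm hab.symm hg hf hk },
    violates_two X Y hac hbc f, violates_two Y.symm X.symm hac.symm hab.symm g⟩

end FilteredComplex
end FilteredRouquier

end

theorem mainTheorem2 {m : ℕ} (i j : Fin m) (hij : (i : ℕ) + 1 = (j : ℕ)) :
    ∃ e : FilteredRouquier.FilteredComplex.HomotopyEquiv
        ((FilteredRouquier.sigmaInv i).tensor
          ((FilteredRouquier.sigmaInv j).tensor (FilteredRouquier.sigmaInv i)))
        ((FilteredRouquier.sigmaInv j).tensor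
          ((FilteredRouquier.sigmaInv i).tensor (FilteredRouquier.sigmaInv j))),
      FilteredRouquier.FilteredComplex.Violates 2 e.f ∧
        FilteredRouquier.FilteredComplex.Violates 2 e.g := by
  have hb : j.castSucc = i.succ := Fin.ext (by simp [hij])
  have hY : FilteredRouquier.FilteredComplex.Crossing (FilteredRouquier.sigmaInv j)
      i.succ j.succ := hb ▸ FilteredRouquier.FilteredComplex.crossingNeg j.castSucc j.succ
  refine FilteredRouquier.FilteredComplex.exists_homotopyEquiv
    (FilteredRouquier.FilteredComplex.crossingNeg i.castSucc i.succ)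
    hY ?_ ?_ ?_ <;>
  · rw [Ne, Fin.ext_iff]
    simp only [Fin.val_castSucc, Fin.val_succ]
    omega
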